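/- Let $x=\{x_t\}_{t\in\mathbb Z}$ and $y=\{y_t\}_{t\in\mathbb Z}$ be zero-mean stationary Gaussian processes with values in $\mathbb R^m$ and with power spectral densities $\Phi_x,\Phi_y$ on the unit circle $\mathbb T$, i.e. $\mathbb E[x_{t+k}x_t^{T}]=\int_{\mathbb T}e^{ik\vartheta}\Phi_x(e^{i\vartheta})$ for all $t,k\in\mathbb Z$, and likewise for $y$, where $\int_{\mathbb T}$ denotes integration with respect to the normalized Lebesgue measure. Let $h=\{h_t\}_{t\in\mathbb Z}$, $h_t\in\mathbb R^{m\times m}$, be the impulse response of a causal ($h_t=0$ for $t<0$) and bounded-input bounded-output stable system, and put $H(e^{i\vartheta})=\sum_{t\ge 0}h_te^{-i\vartheta t}$ and $\Omega=H^*H$. Assume that $\Omega$, $\Phi_x$ and $\Phi_y$ are bounded and coercive, i.e. each of them satisfies $aI\le\,\cdot\,\le bI$ almost everywhere on $\mathbb T$ for some constants $0<a\le b<\infty$. Define $$d_\Omega(p_x,p_y)^2=\inf\ \mathbb E\big[\|(h\star(x'-y'))_t\|^2\big],$$ where the infimum is over all (laws of) jointly Gaussian, jointly stationary pairs of processes $(x',y')$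 such that $(x'_t,x'_s)$ has the same law as $(x_t,x_s)$ and $(y'_u,y'_v)$ has the same law as $(y_u,y_v)$ for all $t,s,u,v\in\mathbb Z$, and $\star$ denotes discrete convolution. Then such pairs exist, their costs are well defined and finite, the integral below is well defined, and for every $t\in\mathbb Z$ $$d_\Omega(p_x,p_y)^2=\operatorname{tr}\int_{\mathbb T}\Big[\Omega\Phi_x+\Omega\Phi_y-2\big(\Phi_y^{1/2}\,\Omega\,\Phi_x\,\Omega\,\Phi_y^{1/2}\big)^{1/2}\Big],$$ where $A^{1/2}$ denotes the positive semidefinite square root of a positive semidefinite matrix $A$. -/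

import Mathlib

open MeasureTheory ProbabilityTheory
open scoped MatrixOrder ComplexOrder

noncomputable section

namespace SpectralTransport

instance fact_two_pi_pos : Fact (0 < 2 * Real.pi) := ⟨Real.two_pi_pos⟩

/-- The unit circle, parametrized by the angle `ϑ` modulo `2π`; the point `ϑ` stands for
`exp (i ϑ)`, and `fourier k ϑ = exp (i k ϑ)`. -/
abbrev Torus : Type := AddCircle (2 * Real.pi)

/-- The normalized Lebesgue measure on the unit circle. -/
abbrev torusMeasure : Measure Torus := AddCircle.haarAddCircle

/-- `ℝ^m` with its Euclidean norm. -/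
abbrev Vec (m : ℕ) : Type := EuclideanSpace ℝ (Fin m)

/-- Complex `m × m` matrices. -/
abbrev CMat (m : ℕ) : Type := Matrix (Fin m) (Fin m) ℂ

/-- The entrywise integral of a matrix function over the unit circle. -/
def torusIntegral {m : ℕ} (M : Torus → CMat m) : CMat m :=
  Matrix.of fun i j => ∫ θ, M θ i j ∂torusMeasure

/-- Every entry of the matrix function is integrable over the unit circle. -/
def TorusIntegrable {m : ℕ} (M : Torus → CMat m) : Prop :=
  ∀ i j, Integrable (fun θ => M θ i j) torusMeasure

/-- Measurable matrix functions on the unit circle that are Hermitian, bounded and coercive: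
`a I ≤ Φ ≤ b I` almost everywhere, for some constants `a > 0` and `b`. -/
structure IsBoundedCoercive {m : ℕ} (Φ : Torus → CMat m) : Prop where
  measurable : ∀ i j, AEStronglyMeasurable (fun θ => Φ θ i j) torusMeasure
  coercive : ∃ a : ℝ, 0 < a ∧
    ∀ᵐ θ ∂torusMeasure, (Φ θ - (a : ℂ) • (1 : CMat m)).PosSemidef
  bounded : ∃ b : ℝ,
    ∀ᵐ θ ∂torusMeasure, ((b : ℂ) • (1 : CMat m) - Φ θ).PosSemidef

/-- The discrete convolution `(h ⋆ z)_t = ∑_s h_s z_{t-s}`. -/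
def conv {m : ℕ} (h : ℤ → Matrix (Fin m) (Fin m) ℝ) (z : ℤ → Vec m) (t : ℤ) : Vec m :=
  ∑' s : ℤ, Matrix.toEuclideanLin (h s) (z (t - s))

/-- The series that defines `(h ⋆ z)_t` converges. -/
def ConvConverges {m : ℕ} (h : ℤ → Matrix (Fin m) (Fin m) ℝ) (z : ℤ → Vec m) (t : ℤ) : Prop :=
  Summable fun s : ℤ => Matrix.toEuclideanLin (h s) (z (t - s))

/-- The system with impulse response `h` is causal. -/
def IsCausal {m : ℕ} (h : ℤ → Matrix (Fin m) (Fin m) ℝ) : Prop :=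
  ∀ t : ℤ, t < 0 → h t = 0

/-- Bounded-input bounded-output stability: for every bounded input `u`, the output `h ⋆ u` is
well defined and bounded. -/
def IsBIBO {m : ℕ} (h : ℤ → Matrix (Fin m) (Fin m) ℝ) : Prop :=
  ∀ u : ℤ → Vec m, (∃ C : ℝ, ∀ t, ‖u t‖ ≤ C) →
    (∀ t, ConvConverges h u t) ∧ ∃ D : ℝ, ∀ t, ‖conv h u t‖ ≤ D

/-- The discrete-time Fourier transform `H(e^{iϑ}) = ∑_t h_t e^{-iϑt}`. -/
def transfer {m : ℕ} (h : ℤ → Matrix (Fin m) (Fin m) ℝ) (θ : Torus) : CMat m :=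
  Matrix.of fun i j => ∑' t : ℤ, ((h t i j : ℝ) : ℂ) * fourier (-t) θ

/-- The weight `Ω = H* H`. -/
def weight {m : ℕ} (h : ℤ → Matrix (Fin m) (Fin m) ℝ) (θ : Torus) : CMat m :=
  (transfer h θ).conjTranspose * transfer h θ

/-- (Strict) stationarity: the law of the process is invariant under all time shifts. -/
def IsStationary {Ω E : Type*} [MeasurableSpace Ω] [MeasurableSpace E]
    (X : ℤ → Ω → E) (P : Measure Ω) : Prop :=
  ∀ k : ℤ, P.map (fun ω t => X (t + k) ω) = P.map (fun ω t => X t ω)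

/-- Zero-mean stationary Gaussian processes with values in `ℝ^m`. -/
structure IsZeroMeanStationaryGaussian {Ω : Type*} [MeasurableSpace Ω] {m : ℕ}
    (X : ℤ → Ω → Vec m) (P : Measure Ω) : Prop where
  gaussian : IsGaussianProcess X P
  stationary : IsStationary X P
  mean_zero : ∀ t, ∫ ω, X t ω ∂P = 0

/-- `Φ` is the power spectral density of the zero-mean stationary process `X`:
`E[X_{t+k} X_tᵀ] = ∫_T e^{ikϑ} Φ(e^{iϑ})` for all `t` and `k`. -/
structure IsSpectralDensity {Ω : Type*} [MeasurableSpace Ω] {m : ℕ}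
    (X : ℤ → Ω → Vec m) (P : Measure Ω) (Φ : Torus → CMat m) : Prop where
  integrable : TorusIntegrable Φ
  covariance : ∀ (t k : ℤ) (i j : Fin m),
    ((∫ ω, X (t + k) ω i * X t ω j ∂P : ℝ) : ℂ) = ∫ θ, fourier k θ * Φ θ i j ∂torusMeasure

/-- Joint laws `π` of a pair of processes (the first component plays the role of `x`, the second
that of `y`) which make the pair a jointly Gaussian, jointly stationary process and whose
two-time marginals are those of `X` and of `Y`. -/
structure IsGaussianCoupling {Ω₁ Ω₂ : Type*} [MeasurableSpace Ω₁] [MeasurableSpace Ω₂] {m : ℕ}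
    (X : ℤ → Ω₁ → Vec m) (P : Measure Ω₁) (Y : ℤ → Ω₂ → Vec m) (Q : Measure Ω₂)
    (π : Measure (ℤ → Vec m × Vec m)) : Prop where
  gaussian : IsGaussianProcess (fun (t : ℤ) (w : ℤ → Vec m × Vec m) => w t) π
  stationary : IsStationary (fun (t : ℤ) (w : ℤ → Vec m × Vec m) => w t) π
  marginal_fst : ∀ t s : ℤ,
    π.map (fun w => ((w t).1, (w s).1)) = P.map (fun ω => (X t ω, X s ω))
  marginal_snd : ∀ u v : ℤ,
    π.map (fun w => ((w u).2, (w v).2)) = Q.map (fun ω => (Y u ω, Y v ω))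

/-- The discrepancy process `x - y`. -/
def discrepancy {m : ℕ} (w : ℤ → Vec m × Vec m) (t : ℤ) : Vec m :=
  (w t).1 - (w t).2

/-- The transportation cost `E ‖(h ⋆ (x - y))_t‖²` of a joint law. -/
def cost {m : ℕ} (h : ℤ → Matrix (Fin m) (Fin m) ℝ) (t : ℤ)
    (π : Measure (ℤ → Vec m × Vec m)) : ℝ :=
  ∫ w, ‖conv h (discrepancy w) t‖ ^ 2 ∂π

/-- The squared transportation distance: the infimum of the cost over all Gaussian couplings. -/
def transportDistSq {Ω₁ Ω₂ : Type*} [MeasurableSpace Ω₁] [MeasurableSpace Ω₂] {m : ℕ}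
    (h : ℤ → Matrix (Fin m) (Fin m) ℝ)
    (X : ℤ → Ω₁ → Vec m) (P : Measure Ω₁) (Y : ℤ → Ω₂ → Vec m) (Q : Measure Ω₂) (t : ℤ) : ℝ :=
  sInf {c : ℝ | ∃ π, IsGaussianCoupling X P Y Q π ∧ c = cost h t π}

/-- `ΩΦ_x + ΩΦ_y - 2 (Φ_y^{1/2} Ω Φ_x Ω Φ_y^{1/2})^{1/2}`, where `A^{1/2}` is the positive
semidefinite square root of a positive semidefinite matrix `A`. -/
def hellingerIntegrand {m : ℕ} (Ω Φx Φy : Torus → CMat m) (θ : Torus) : CMat m :=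
  Ω θ * Φx θ + Ω θ * Φy θ
    - (2 : ℂ) • CFC.sqrt (CFC.sqrt (Φy θ) * Ω θ * Φx θ * Ω θ * CFC.sqrt (Φy θ))

end SpectralTransport

end

/-! In the frequency domain the problem decouples into one matrix problem per angle. The two-time
marginals fix the autocovariances of both components, so the only freedom left in a coupling that
affects the cost is its cross density `Ψ`. The discrepancy then has density `Φx - Ψ - Ψᴴ + Φy`, and
filtering by `h` turns the cost into `Re ∫ tr Ω (Φx - Ψ - Ψᴴ + Φy)` (`conv_second_moment`). The
constraint on `Ψ` is that the block matrix with rows `(Φx, Ψ)` and `(Ψᴴ, Φy)` be positive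
semidefinite almost everywhere.

At a fixed angle this is a weighted Bures–Wasserstein problem. Write `B = Φy^{1/2}` and `S = (B Ω Φx
Ω B)^{1/2}`. Testing the block matrix against a suitable pair of matrices gives `Re tr Ω (Ψ + Ψᴴ) ≤
2 tr S` (`re_trace_le_of_fromBlocks_posSemidef`). Equality holds for `Ψ = A B` with `A = Φx Ω B
S⁻¹`, which satisfies `A Aᴴ = Φx` (`optimal_cost`).

Two facts carry this back to processes. For the lower bound, every coupling must have a cross
density: boundedness of `Φx` and Bessel's inequality make the cross correlations square summable
(`summable_sq_correlation`), Riesz–Fischer gives `Ψ` in `L²`, and trigonometric test polynomials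
give semidefiniteness (`ae_posSemidef_of_covariance`). For attainment, the vectors `e^{itϑ}` times
the rows of `A` and of `B` lie in a real `L²` space, and a Gaussian process with their Gram matrix
as covariance is an optimal coupling (`exists_coupling_of_factors`). It realises only the real parts
of the Fourier coefficients of `A Bᴴ`. This is harmless: `h` is real, so the cost sees nothing else,
and the marginals have real covariances anyway. No conjugate symmetry of `A` is therefore needed. -/

noncomputable section

namespace SpectralTransport

/-! ### Measurability of matrix square roots and inverses -/

section
open Matrix

section
open scoped Matrix.Norms.L2Operator

theorem continuous_sqrt_comp {X : Type*} [TopologicalSpace X] {m : ℕ} {f : X → CMat m}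
    (hf : Continuous f) (hf0 : ∀ x, 0 ≤ f x) : Continuous fun x => CFC.sqrt (f x) := by
  simp_rw [CFC.sqrt_eq_cfc]
  exact Continuous.cfc_nnreal_of_mem_nhdsSet (s := Set.univ) _ Filter.univ_mem hf hf0
    NNReal.continuous_sqrt.continuousOn

end

/-- A globally continuous function that agrees with the square root on positive semidefinite
matrices. Composing with it gives measurability of `CFC.sqrt (M x)` even when `M x` is semidefinite
only almost everywhere. -/
theorem continuous_sqrt_sqrt {m : ℕ} :
    Continuous fun M : CMat m => CFC.sqrt (CFC.sqrt (Mᴴ * M)) := by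
  refine continuous_sqrt_comp (continuous_sqrt_comp (by fun_prop) fun M => ?_)
    fun M => CFC.sqrt_nonneg _
  exact (posSemidef_conjTranspose_mul_self M).nonneg

theorem sqrt_sqrt_conjTranspose_mul_self {m : ℕ} {M : CMat m} (hM : M.PosSemidef) :
    CFC.sqrt (CFC.sqrt (Mᴴ * M)) = CFC.sqrt M := by
  rw [hM.1.eq, CFC.sqrt_mul_self M hM.nonneg]

theorem aestronglyMeasurable_matrix_iff {α : Type*} [MeasurableSpace α] {μ : Measure α}
    {m : ℕ} {M : α → CMat m} :
    AEStronglyMeasurable M μ ↔ ∀ i j, AEStronglyMeasurable (fun x => M x i j) μ := by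
  constructor
  · intro h i j
    exact (Continuous.comp_aestronglyMeasurable (g := fun A : CMat m => A i j) (by fun_prop) h)
  · intro h
    have h1 : AEStronglyMeasurable (fun x => (fun i j => M x i j : Fin m → Fin m → ℂ)) μ :=
      (aemeasurable_pi_iff.2 fun i => aemeasurable_pi_iff.2 fun j =>
        (h i j).aemeasurable).aestronglyMeasurable
    exact h1

theorem aestronglyMeasurable_sqrt {α : Type*} [MeasurableSpace α] {μ : Measure α}
    {m : ℕ} {M : α → CMat m} (hM : AEStronglyMeasurable M μ) (h0 : ∀ᵐ x ∂μ, (M x).PosSemidef) :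
    AEStronglyMeasurable (fun x => CFC.sqrt (M x)) μ := by
  refine (continuous_sqrt_sqrt.comp_aestronglyMeasurable hM).congr ?_
  filter_upwards [h0] with x hx using sqrt_sqrt_conjTranspose_mul_self hx

/-- Inversion is not continuous at singular matrices, but Cramer's rule factors it through the
continuous adjugate and the scalar inverse of the determinant, which is measurable. -/
theorem aestronglyMeasurable_inv {α : Type*} [MeasurableSpace α] {μ : Measure α}
    {m : ℕ} {M : α → CMat m} (hM : AEStronglyMeasurable M μ) :
    AEStronglyMeasurable (fun x => (M x)⁻¹) μ := by
  simp_rw [Matrix.inv_def, Ring.inverse_eq_inv']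
  have h1 : AEStronglyMeasurable (fun x => (M x).det) μ :=
    (Continuous.matrix_det continuous_id).comp_aestronglyMeasurable hM
  have h2 : AEStronglyMeasurable (fun x => (M x).adjugate) μ :=
    (Continuous.matrix_adjugate continuous_id).comp_aestronglyMeasurable hM
  exact (h1.aemeasurable.inv.aestronglyMeasurable).smul h2

/-! ### The matrix optimisation problem at a fixed angle -/

theorem trace_conjTranspose_mul_mul_nonneg {n k : Type*} [Fintype n] [Fintype k]
    {F : Matrix n n ℂ} (hF : F.PosSemidef) (N : Matrix n k ℂ) : 0 ≤ (Nᴴ * F * N).trace :=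
  (hF.conjTranspose_mul_mul_same N).trace_nonneg

/-- The root `(Φy^{1/2} Ω Φx Ω Φy^{1/2})^{1/2}`. -/
def crossRoot {m : ℕ} (Ω Φx Φy : CMat m) : CMat m :=
  CFC.sqrt (CFC.sqrt Φy * Ω * Φx * Ω * CFC.sqrt Φy)

/-- The optimal factor `A`, with `A Aᴴ = Φx`, coupled to `CFC.sqrt Φy`. -/
def optimalFactor {m : ℕ} (Ω Φx Φy : CMat m) : CMat m :=
  Φx * Ω * CFC.sqrt Φy * (crossRoot Ω Φx Φy)⁻¹

section pointwise
variable {m : ℕ} {Ω Φx Φy : CMat m}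

theorem sqrt_isHermitian (M : CMat m) : (CFC.sqrt M)ᴴ = CFC.sqrt M :=
  (CFC.sqrt_nonneg M).posSemidef.1.eq

theorem posDef_sqrt {M : CMat m} (hM : M.PosDef) : (CFC.sqrt M).PosDef := by
  refine (CFC.sqrt_nonneg M).posSemidef.posDef_iff_isUnit.2 ?_
  have h : CFC.sqrt M * CFC.sqrt M = M := CFC.sqrt_mul_sqrt_self M hM.posSemidef.nonneg
  have := hM.isUnit
  rw [← h] at this
  exact isUnit_of_mul_isUnit_left this

theorem cross_posSemidef (hΩ : Ω.IsHermitian) (hx : Φx.PosSemidef) :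
    (CFC.sqrt Φy * Ω * Φx * Ω * CFC.sqrt Φy).PosSemidef := by
  have h := hx.conjTranspose_mul_mul_same (Ω * CFC.sqrt Φy)
  rwa [conjTranspose_mul, sqrt_isHermitian, hΩ.eq, ← Matrix.mul_assoc] at h

theorem cross_posDef (hΩ : Ω.PosDef) (hx : Φx.PosDef) (hy : Φy.PosDef) :
    (CFC.sqrt Φy * Ω * Φx * Ω * CFC.sqrt Φy).PosDef := by
  refine (cross_posSemidef hΩ.1 hx.posSemidef).posDef_iff_isUnit.2 ?_
  exact ((((posDef_sqrt hy).isUnit.mul hΩ.isUnit).mul hx.isUnit).mul hΩ.isUnit).mul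
    (posDef_sqrt hy).isUnit

theorem crossRoot_mul_self (hΩ : Ω.IsHermitian) (hx : Φx.PosSemidef) :
    crossRoot Ω Φx Φy * crossRoot Ω Φx Φy = CFC.sqrt Φy * Ω * Φx * Ω * CFC.sqrt Φy :=
  CFC.sqrt_mul_sqrt_self _ (cross_posSemidef hΩ hx).nonneg

theorem crossRoot_posDef (hΩ : Ω.PosDef) (hx : Φx.PosDef) (hy : Φy.PosDef) :
    (crossRoot Ω Φx Φy).PosDef := posDef_sqrt (cross_posDef hΩ hx hy)

/-- Since `S² = B Ω Φx Ω B` with all factors invertible, `S⁻² = B⁻¹ Ω⁻¹ Φx⁻¹ Ω⁻¹ B⁻¹`, and `Φx Ω B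
S⁻² B Ω Φx` telescopes to `Φx`. -/
theorem optimalFactor_mul_conjTranspose (hΩ : Ω.PosDef) (hx : Φx.PosDef) (hy : Φy.PosDef) :
    optimalFactor Ω Φx Φy * (optimalFactor Ω Φx Φy)ᴴ = Φx := by
  have hS := crossRoot_posDef hΩ hx hy
  have hSS := crossRoot_mul_self (Φy := Φy) hΩ.1 hx.posSemidef
  have hB := posDef_sqrt hy
  set S := crossRoot Ω Φx Φy with hSdef
  set B := CFC.sqrt Φy
  have huS := (Matrix.isUnit_iff_isUnit_det _).1 hS.isUnit
  have huB := (Matrix.isUnit_iff_isUnit_det _).1 hB.isUnit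
  have huO := (Matrix.isUnit_iff_isUnit_det _).1 hΩ.isUnit
  have hux := (Matrix.isUnit_iff_isUnit_det _).1 hx.isUnit
  have hinv : S⁻¹ * S⁻¹ = B⁻¹ * Ω⁻¹ * Φx⁻¹ * Ω⁻¹ * B⁻¹ := by
    rw [← Matrix.mul_inv_rev, hSS]
    simp only [Matrix.mul_inv_rev, Matrix.mul_assoc]
  have hA : (optimalFactor Ω Φx Φy)ᴴ = S⁻¹ * B * Ω * Φx := by
    simp only [optimalFactor, conjTranspose_mul, conjTranspose_nonsing_inv, hΩ.1.eq, hx.1.eq,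
      hB.1.eq, hS.1.eq, ← hSdef, Matrix.mul_assoc, B]
  rw [hA, optimalFactor, ← hSdef]
  calc Φx * Ω * B * S⁻¹ * (S⁻¹ * B * Ω * Φx)
      = Φx * Ω * B * (S⁻¹ * S⁻¹) * B * Ω * Φx := by simp only [Matrix.mul_assoc]
    _ = Φx * (Ω * (B * B⁻¹) * Ω⁻¹) * Φx⁻¹ * (Ω⁻¹ * (B⁻¹ * B) * Ω) * Φx := by
        rw [hinv]; simp only [Matrix.mul_assoc]
    _ = Φx := by
        rw [Matrix.mul_nonsing_inv _ huB, Matrix.nonsing_inv_mul _ huB, Matrix.mul_one,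
          Matrix.mul_nonsing_inv _ huO, Matrix.mul_one, Matrix.mul_one,
          Matrix.nonsing_inv_mul _ huO, Matrix.mul_one, Matrix.mul_nonsing_inv _ hux, Matrix.one_mul]

/-- Moving the last `B` to the front by cyclicity produces `B Ω Φx Ω B S⁻¹ = S² S⁻¹`. -/
theorem trace_weight_mul_optimal (hΩ : Ω.PosDef) (hx : Φx.PosDef) (hy : Φy.PosDef) :
    (Ω * (optimalFactor Ω Φx Φy * CFC.sqrt Φy)).trace = (crossRoot Ω Φx Φy).trace := by
  have hS := crossRoot_posDef hΩ hx hy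
  have hSS := crossRoot_mul_self (Φy := Φy) hΩ.1 hx.posSemidef
  have huS := (Matrix.isUnit_iff_isUnit_det _).1 hS.isUnit
  rw [optimalFactor]
  set S := crossRoot Ω Φx Φy
  set B := CFC.sqrt Φy
  calc (Ω * (Φx * Ω * B * S⁻¹ * B)).trace = ((Ω * Φx * Ω * B * S⁻¹) * B).trace := by
        simp only [Matrix.mul_assoc]
    _ = (B * (Ω * Φx * Ω * B * S⁻¹)).trace := Matrix.trace_mul_comm _ _
    _ = ((S * S) * S⁻¹).trace := by rw [hSS]; simp only [Matrix.mul_assoc]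
    _ = S.trace := by
        rw [Matrix.mul_assoc, Matrix.mul_nonsing_inv _ huS, Matrix.mul_one]

theorem optimal_cost (hΩ : Ω.PosDef) (hx : Φx.PosDef) (hy : Φy.PosDef) :
    (Ω * ((optimalFactor Ω Φx Φy - CFC.sqrt Φy) * (optimalFactor Ω Φx Φy - CFC.sqrt Φy)ᴴ)).trace =
      (Ω * Φx + Ω * Φy - (2 : ℂ) • crossRoot Ω Φx Φy).trace := by
  have h1 := optimalFactor_mul_conjTranspose hΩ hx hy
  have h2 := trace_weight_mul_optimal hΩ hx hy
  have hS := crossRoot_posDef hΩ hx hy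
  have h3 : (Ω * (CFC.sqrt Φy * (optimalFactor Ω Φx Φy)ᴴ)).trace = (crossRoot Ω Φx Φy).trace := by
    have := congrArg star h2
    rw [← Matrix.trace_conjTranspose, ← Matrix.trace_conjTranspose, hS.1.eq] at this
    rw [← this, conjTranspose_mul, conjTranspose_mul, sqrt_isHermitian, hΩ.1.eq,
      Matrix.trace_mul_comm]
  have h4 : CFC.sqrt Φy * CFC.sqrt Φy = Φy := CFC.sqrt_mul_sqrt_self _ hy.posSemidef.nonneg
  rw [conjTranspose_sub, sqrt_isHermitian, Matrix.mul_sub, Matrix.sub_mul, Matrix.sub_mul, h1, h4]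
  simp only [Matrix.mul_sub, Matrix.trace_sub, Matrix.trace_add, h2, h3, Matrix.trace_smul,
    smul_eq_mul]
  ring

/-- Weak duality: a block column `N` is chosen so that `tr (Nᴴ F N) = 2 tr S - tr (Ω Ψ) - tr (Ω
Ψᴴ)`, where `F` is the block matrix. Nonnegativity of this trace is the bound. -/
theorem re_trace_le_of_fromBlocks_posSemidef (hΩ : Ω.PosDef) (hx : Φx.PosDef) (hy : Φy.PosDef)
    {Ψ : CMat m} (hF : (fromBlocks Φx Ψ Ψᴴ Φy).PosSemidef) :
    ((Ω * Φx + Ω * Φy - (2 : ℂ) • crossRoot Ω Φx Φy).trace).re ≤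
      ((Ω * (Φx - Ψ - Ψᴴ + Φy)).trace).re := by
  have hS := crossRoot_posDef hΩ hx hy
  have hSS := crossRoot_mul_self (Φy := Φy) hΩ.1 hx.posSemidef
  have hB := posDef_sqrt hy
  have hR := posDef_sqrt hS
  have hRR : CFC.sqrt (crossRoot Ω Φx Φy) * CFC.sqrt (crossRoot Ω Φx Φy) = crossRoot Ω Φx Φy :=
    CFC.sqrt_mul_sqrt_self _ hS.posSemidef.nonneg
  have hBB : CFC.sqrt Φy * CFC.sqrt Φy = Φy := CFC.sqrt_mul_sqrt_self _ hy.posSemidef.nonneg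
  set S := crossRoot Ω Φx Φy
  set B := CFC.sqrt Φy
  set R := CFC.sqrt S
  have huB := (Matrix.isUnit_iff_isUnit_det _).1 hB.isUnit
  have huR := (Matrix.isUnit_iff_isUnit_det _).1 hR.isUnit
  -- With `R = S^{1/2}`, the upper block times the adjoint of the lower one is `-Ω`, which yields
  -- the cross terms. The powers of `R` are balanced so that each diagonal block contributes exactly
  -- `tr S`.
  have key := trace_conjTranspose_mul_mul_nonneg hF (fromRows (Ω * B * R⁻¹) (-(B⁻¹ * R)))
  have e : (fromRows (Ω * B * R⁻¹) (-(B⁻¹ * R)))ᴴ * fromBlocks Φx Ψ Ψᴴ Φy *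
      fromRows (Ω * B * R⁻¹) (-(B⁻¹ * R)) =
      R⁻¹ * B * Ω * Φx * (Ω * B * R⁻¹) - R⁻¹ * B * Ω * Ψ * (B⁻¹ * R)
       - (R * B⁻¹ * Ψᴴ * (Ω * B * R⁻¹)) + R * B⁻¹ * Φy * (B⁻¹ * R) := by
    rw [Matrix.mul_assoc, fromBlocks_mul_fromRows, conjTranspose_fromRows_eq_fromCols_conjTranspose,
      fromCols_mul_fromRows]
    simp only [conjTranspose_mul, conjTranspose_neg, conjTranspose_nonsing_inv, hΩ.1.eq, hB.1.eq,
      hR.1.eq]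
    simp only [Matrix.mul_add, Matrix.mul_neg, Matrix.neg_mul, Matrix.mul_assoc]
    abel
  rw [e] at key
  have t1 : (R⁻¹ * B * Ω * Φx * (Ω * B * R⁻¹)).trace = S.trace := by
    calc _ = (R⁻¹ * (S * S) * R⁻¹).trace := by rw [hSS]; simp only [Matrix.mul_assoc]
      _ = ((R⁻¹ * R) * R * R * (R * R⁻¹)).trace := by rw [← hRR]; simp only [Matrix.mul_assoc]
      _ = S.trace := by
        rw [Matrix.nonsing_inv_mul _ huR, Matrix.mul_nonsing_inv _ huR, Matrix.one_mul,
          Matrix.mul_one, hRR]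
  have t4 : (R * B⁻¹ * Φy * (B⁻¹ * R)).trace = S.trace := by
    calc _ = (R * (B⁻¹ * B) * (B * B⁻¹) * R).trace := by
          rw [← hBB]; simp only [Matrix.mul_assoc]
      _ = S.trace := by
        rw [Matrix.nonsing_inv_mul _ huB, Matrix.mul_nonsing_inv _ huB, Matrix.mul_one,
          Matrix.mul_one, hRR]
  have t2 : (R⁻¹ * B * Ω * Ψ * (B⁻¹ * R)).trace = (Ω * Ψ).trace := by
    calc _ = ((R⁻¹ * (B * Ω * Ψ * B⁻¹)) * R).trace := by simp only [Matrix.mul_assoc]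
      _ = ((R * R⁻¹) * (B * Ω * Ψ * B⁻¹)).trace := by
          rw [Matrix.trace_mul_comm]; simp only [Matrix.mul_assoc]
      _ = ((B * (Ω * Ψ)) * B⁻¹).trace := by
          rw [Matrix.mul_nonsing_inv _ huR, Matrix.one_mul]; simp only [Matrix.mul_assoc]
      _ = ((B⁻¹ * B) * (Ω * Ψ)).trace := by
          rw [Matrix.trace_mul_comm]; simp only [Matrix.mul_assoc]
      _ = _ := by rw [Matrix.nonsing_inv_mul _ huB, Matrix.one_mul]
  have t3 : (R * B⁻¹ * Ψᴴ * (Ω * B * R⁻¹)).trace = (Ω * Ψᴴ).trace := by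
    calc _ = ((R * (B⁻¹ * Ψᴴ * Ω * B)) * R⁻¹).trace := by simp only [Matrix.mul_assoc]
      _ = ((R⁻¹ * R) * (B⁻¹ * Ψᴴ * Ω * B)).trace := by
          rw [Matrix.trace_mul_comm]; simp only [Matrix.mul_assoc]
      _ = ((B⁻¹ * (Ψᴴ * Ω)) * B).trace := by
          rw [Matrix.nonsing_inv_mul _ huR, Matrix.one_mul]; simp only [Matrix.mul_assoc]
      _ = ((B * B⁻¹) * (Ψᴴ * Ω)).trace := by
          rw [Matrix.trace_mul_comm]; simp only [Matrix.mul_assoc]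
      _ = _ := by rw [Matrix.mul_nonsing_inv _ huB, Matrix.one_mul, Matrix.trace_mul_comm]
  rw [Matrix.trace_add, Matrix.trace_sub, Matrix.trace_sub, t1, t2, t3, t4] at key
  have := (Complex.le_def.1 key).1
  simp only [Matrix.mul_add, Matrix.mul_sub, Matrix.trace_add, Matrix.trace_sub, Matrix.trace_smul,
    smul_eq_mul, Complex.add_re, Complex.sub_re, Complex.mul_re, Complex.re_ofNat, Complex.im_ofNat,
    Complex.zero_re] at this ⊢
  linarith

end pointwise

end

/-! ### Second moments of filtered processes -/

theorem ae_summable_norm_of_summable_integral_norm {α ι E : Type*} [MeasurableSpace α]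
    {μ : Measure α} [Countable ι] [NormedAddCommGroup E] {F : ι → α → E}
    (hF : ∀ i, Integrable (F i) μ) (hs : Summable fun i => ∫ a, ‖F i a‖ ∂μ) :
    (∀ᵐ a ∂μ, Summable fun i => ‖F i a‖) ∧ Integrable (fun a => ∑' i, ‖F i a‖) μ := by
  have h1 : ∫⁻ a, ∑' i, ‖F i a‖ₑ ∂μ < ⊤ := by
    rw [lintegral_tsum fun i => (hF i).1.enorm]
    have : ∀ i, ∫⁻ a, ‖F i a‖ₑ ∂μ = ENNReal.ofReal (∫ a, ‖F i a‖ ∂μ) := fun i =>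
      (ofReal_integral_norm_eq_lintegral_enorm (hF i)).symm
    simp_rw [this]
    rw [← ENNReal.ofReal_tsum_of_nonneg (fun i => integral_nonneg fun a => norm_nonneg _) hs]
    exact ENNReal.ofReal_lt_top
  have h2 : ∀ᵐ a ∂μ, Summable fun i => ‖F i a‖ := by
    filter_upwards [ae_lt_top' (AEMeasurable.tsum fun i => (hF i).1.enorm) h1.ne] with a ha
    have h3 : Summable fun i => ‖F i a‖₊ := by
      rw [← ENNReal.tsum_coe_ne_top_iff_summable]
      simpa [enorm_eq_nnnorm] using ha.ne
    simpa using NNReal.summable_coe.2 h3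
  have h4 : ∀ᵐ a ∂μ, ‖∑' i, ‖F i a‖‖ₑ = ∑' i, ‖F i a‖ₑ := by
    filter_upwards [h2] with a ha
    rw [Real.enorm_of_nonneg (tsum_nonneg fun i => norm_nonneg _),
      ENNReal.ofReal_tsum_of_nonneg (fun i => norm_nonneg _) ha]
    simp
  refine ⟨h2, AEMeasurable.aestronglyMeasurable
    (AEMeasurable.tsum fun i => (hF i).1.norm.aemeasurable), ?_⟩
  rw [hasFiniteIntegral_iff_enorm, lintegral_congr_ae h4]
  exact h1

theorem hasSum_inner_prod {ι E : Type*} [NormedAddCommGroup E] [InnerProductSpace ℝ E]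
    [CompleteSpace E] {a : ι → E} (ha : Summable fun i => ‖a i‖) :
    HasSum (fun p : ι × ι => inner ℝ (a p.1) (a p.2)) (‖∑' i, a i‖ ^ 2) := by
  have h1 : Summable fun p : ι × ι => inner ℝ (a p.1) (a p.2) := by
    refine Summable.of_norm_bounded (ha.mul_of_nonneg ha (fun _ => norm_nonneg _)
      fun _ => norm_nonneg _) fun p => ?_
    exact norm_inner_le_norm _ _
  convert h1.hasSum using 1
  rw [h1.tsum_prod, ← real_inner_self_eq_norm_sq]
  have h2 : ∀ v : E, inner ℝ v (∑' i, a i) = ∑' i, inner ℝ v (a i) := fun v =>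
    (innerSL ℝ v).map_tsum ha.of_norm
  rw [h2]
  refine tsum_congr fun i => ?_
  rw [real_inner_comm, h2]

theorem summable_prod_mul_of_nonneg {ι : Type*} {f : ι → ℝ} (hf : Summable f)
    (h0 : ∀ i, 0 ≤ f i) : Summable fun p : ι × ι => f p.1 * f p.2 :=
  hf.mul_of_nonneg hf h0 h0

/-- The sum of the absolute values of the entries of a matrix. -/
def entrySum {m : ℕ} (M : Matrix (Fin m) (Fin m) ℝ) : ℝ := ∑ i, ∑ j, |M i j|

theorem entrySum_nonneg {m : ℕ} (M : Matrix (Fin m) (Fin m) ℝ) : 0 ≤ entrySum M :=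
  Finset.sum_nonneg fun _ _ => Finset.sum_nonneg fun _ _ => abs_nonneg _

theorem abs_le_entrySum {m : ℕ} (M : Matrix (Fin m) (Fin m) ℝ) (i j : Fin m) :
    |M i j| ≤ entrySum M :=
  (Finset.single_le_sum (f := fun j => |M i j|) (fun _ _ => abs_nonneg _)
    (Finset.mem_univ j)).trans
    (Finset.single_le_sum (f := fun i => ∑ j, |M i j|)
      (fun _ _ => Finset.sum_nonneg fun _ _ => abs_nonneg _) (Finset.mem_univ i))

theorem toEuclideanLin_apply' {m : ℕ} (M : Matrix (Fin m) (Fin m) ℝ) (v : Vec m) (i : Fin m) :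
    Matrix.toEuclideanLin M v i = ∑ j, M i j * v j := by
  simp [Matrix.toLpLin_apply, Matrix.mulVec, dotProduct]

theorem norm_le_sum_abs {m : ℕ} (v : Vec m) : ‖v‖ ≤ ∑ i, |v i| := by
  rw [EuclideanSpace.norm_eq]
  refine Real.sqrt_le_iff.2 ⟨Finset.sum_nonneg fun _ _ => abs_nonneg _, ?_⟩
  simpa using Finset.sum_sq_le_sq_sum_of_nonneg (s := Finset.univ) (f := fun i => |v i|)
    fun _ _ => abs_nonneg _

theorem norm_toEuclideanLin_le {m : ℕ} (M : Matrix (Fin m) (Fin m) ℝ) (v : Vec m) :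
    ‖Matrix.toEuclideanLin M v‖ ≤ entrySum M * ‖v‖ := by
  refine (norm_le_sum_abs _).trans ?_
  rw [entrySum, Finset.sum_mul]
  refine Finset.sum_le_sum fun i _ => ?_
  rw [toEuclideanLin_apply', Finset.sum_mul]
  refine (Finset.abs_sum_le_sum_abs _ _).trans (Finset.sum_le_sum fun j _ => ?_)
  rw [abs_mul]
  exact mul_le_mul_of_nonneg_left (by simpa using PiLp.norm_apply_le v j) (abs_nonneg _)

/-- For each entry `(i, j)`, feed in the bounded input along `e_j` that carries the time-reversed
signs of `h · i j`. The `i`-th coordinate of the output series at time `0` is then `∑ |h s i j|`,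
and it converges by stability. -/
theorem IsBIBO.summable_entrySum {m : ℕ} {h : ℤ → Matrix (Fin m) (Fin m) ℝ} (hh : IsBIBO h) :
    Summable fun t => entrySum (h t) := by
  refine summable_sum fun i _ => summable_sum fun j _ => ?_
  have h1 := ((hh (fun t => EuclideanSpace.single j (SignType.sign (h (-t) i j) : ℝ))
    ⟨1, fun t => ?_⟩).1 0)
  · have h2 : Summable fun s => (EuclideanSpace.proj (𝕜 := ℝ) i : Vec m →L[ℝ] ℝ)
        (Matrix.toEuclideanLin (h s) (EuclideanSpace.single j
          (SignType.sign (h (-(0 - s)) i j) : ℝ))) :=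
      (EuclideanSpace.proj (𝕜 := ℝ) i : Vec m →L[ℝ] ℝ).summable h1
    refine h2.congr fun s => ?_
    rw [PiLp.proj_apply, toEuclideanLin_apply', Finset.sum_eq_single j]
    · simp
    · intro b _ hb
      simp [hb]
    · simp
  · rw [PiLp.norm_single]
    cases SignType.sign (h (-t) i j) <;> simp

theorem norm_fourier_apply (k : ℤ) (θ : Torus) : ‖fourier k θ‖ = 1 := by
  rw [fourier_apply]; exact Circle.norm_coe _

theorem star_fourier (k : ℤ) (θ : Torus) : star (fourier k θ : ℂ) = fourier (-k) θ := by
  rw [fourier_neg]; rfl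

theorem integrable_fourier_mul {f : Torus → ℂ} (hf : Integrable f torusMeasure) (k : ℤ) :
    Integrable (fun θ => fourier k θ * f θ) torusMeasure :=
  hf.bdd_mul (c := 1) (fourier k).continuous.aestronglyMeasurable
    (Filter.Eventually.of_forall fun θ => (norm_fourier_apply k θ).le)

theorem hasSum_mul_prod {ι : Type*} {f g : ι → ℂ} {a b : ℂ} (ha : HasSum f a) (hb : HasSum g b)
    (hf : Summable fun i => ‖f i‖) (hg : Summable fun i => ‖g i‖) (c : ℂ) :
    HasSum (fun p : ι × ι => f p.1 * g p.2 * c) (a * b * c) :=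
  (ha.mul hb (summable_mul_of_summable_norm hf hg)).mul_right c

/-- Conjugation turns `e^{-isϑ}` in `transfer` into `e^{isϑ}`, so the pair `(s, r)` carries the
frequency `s - r`. This is the lag between `z (t - r)` and `z (t - s)` in the expansion of the
output power. -/
theorem hasSum_trace_weight {m : ℕ} {h : ℤ → Matrix (Fin m) (Fin m) ℝ}
    (hs : Summable fun t => entrySum (h t)) (Φ : CMat m) (θ : Torus) :
    HasSum (fun p : ℤ × ℤ => ∑ i, ∑ j, ∑ k, ((h p.1 k i * h p.2 k j : ℝ) : ℂ) *
      (fourier (p.1 - p.2) θ * Φ j i)) (weight h θ * Φ).trace := by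
  have hn : ∀ k i, Summable fun s => ‖((h s k i : ℝ) : ℂ) * fourier (-s) θ‖ := fun k i => by
    refine Summable.of_nonneg_of_le (fun _ => norm_nonneg _) (fun s => ?_) hs
    rw [norm_mul, norm_fourier_apply, mul_one, Complex.norm_real]
    exact abs_le_entrySum _ _ _
  have e : (weight h θ * Φ).trace = ∑ i, ∑ j, ∑ k,
      star (transfer h θ k i) * transfer h θ k j * Φ j i := by
    simp only [weight, Matrix.trace, Matrix.diag, Matrix.mul_apply, Finset.sum_mul,
      Matrix.conjTranspose_apply]
  have key : ∀ i j k, HasSum (fun p : ℤ × ℤ => ((h p.1 k i * h p.2 k j : ℝ) : ℂ) *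
      (fourier (p.1 - p.2) θ * Φ j i)) (star (transfer h θ k i) * transfer h θ k j * Φ j i) := by
    intro i j k
    have h1 : HasSum (fun s => ((h s k i : ℝ) : ℂ) * fourier s θ) (star (transfer h θ k i)) := by
      have h0 : HasSum (fun s => ((h s k i : ℝ) : ℂ) * fourier (-s) θ) (transfer h θ k i) :=
        (hn k i).of_norm.hasSum
      refine h0.star.congr_fun fun s => ?_
      rw [star_mul', star_fourier, neg_neg, RCLike.star_def, Complex.conj_ofReal]
    have h2 : HasSum (fun s => ((h s k j : ℝ) : ℂ) * fourier (-s) θ) (transfer h θ k j) :=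
      (hn k j).of_norm.hasSum
    have hn' : Summable fun s => ‖((h s k i : ℝ) : ℂ) * fourier s θ‖ := by
      refine (hn k i).congr fun s => ?_
      rw [norm_mul, norm_mul, norm_fourier_apply, norm_fourier_apply]
    have h3 := hasSum_mul_prod h1 h2 hn' (hn k j) (Φ j i)
    refine h3.congr_fun fun p => ?_
    rw [sub_eq_add_neg, fourier_add, Complex.ofReal_mul]
    ring
  rw [e]
  exact hasSum_sum fun i _ => hasSum_sum fun j _ => hasSum_sum fun k _ => key i j k

theorem integral_norm_mul_norm_le {α E : Type*} [MeasurableSpace α] {μ : Measure α}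
    [NormedAddCommGroup E] {f g : α → E} (hf : MemLp f 2 μ) (hg : MemLp g 2 μ)
    {C : ℝ} (hfC : ∫ a, ‖f a‖ ^ 2 ∂μ ≤ C) (hgC : ∫ a, ‖g a‖ ^ 2 ∂μ ≤ C) :
    Integrable (fun a => ‖f a‖ * ‖g a‖) μ ∧ ∫ a, ‖f a‖ * ‖g a‖ ∂μ ≤ C := by
  have hi : Integrable (fun a => ‖f a‖ * ‖g a‖) μ := hf.norm.integrable_mul hg.norm
  have hf2 := hf.integrable_norm_pow (p := 2) (by norm_num)
  have hg2 := hg.integrable_norm_pow (p := 2) (by norm_num)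
  refine ⟨hi, ?_⟩
  calc ∫ a, ‖f a‖ * ‖g a‖ ∂μ ≤ ∫ a, (‖f a‖ ^ 2 + ‖g a‖ ^ 2) / 2 ∂μ := by
        refine integral_mono hi ((hf2.add hg2).div_const 2) fun a => ?_
        change ‖f a‖ * ‖g a‖ ≤ (‖f a‖ ^ 2 + ‖g a‖ ^ 2) / 2
        nlinarith [sq_nonneg (‖f a‖ - ‖g a‖)]
    _ ≤ C := by
        rw [integral_div, integral_add hf2 hg2]
        linarith

theorem MemLp.euclidean_apply {α : Type*} [MeasurableSpace α] {μ : Measure α} {m : ℕ}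
    {f : α → Vec m} (hf : MemLp f 2 μ) (i : Fin m) : MemLp (fun a => f a i) 2 μ :=
  (EuclideanSpace.proj (𝕜 := ℝ) i : Vec m →L[ℝ] ℝ).comp_memLp' hf

theorem inner_toEuclideanLin {m : ℕ} (M N : Matrix (Fin m) (Fin m) ℝ) (u v : Vec m) :
    (inner ℝ (Matrix.toEuclideanLin M u) (Matrix.toEuclideanLin N v) : ℝ) = ∑ i, ∑ j, ∑ k,
      (M k i * N k j) * (v j * u i) := by
  rw [PiLp.inner_apply]
  simp only [toEuclideanLin_apply', RCLike.inner_apply, conj_trivial, Finset.sum_mul_sum]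
  calc _ = ∑ k, ∑ i, ∑ j, (M k i * N k j) * (v j * u i) := by
        refine Finset.sum_congr rfl fun k _ => ?_
        rw [Finset.sum_comm]
        refine Finset.sum_congr rfl fun i _ => Finset.sum_congr rfl fun j _ => ?_
        ring
    _ = _ := by
        rw [Finset.sum_comm]
        exact Finset.sum_congr rfl fun i _ => Finset.sum_comm

theorem hasSum_integral_trace_weight {m : ℕ} {Φ : Torus → CMat m} (hΦ : TorusIntegrable Φ)
    {h : ℤ → Matrix (Fin m) (Fin m) ℝ} (hs : Summable fun t => entrySum (h t)) :
    HasSum (fun p : ℤ × ℤ => ∑ i, ∑ j, ∑ k, ((h p.1 k i * h p.2 k j : ℝ) : ℂ) *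
      ∫ θ, fourier (p.1 - p.2) θ * Φ θ j i ∂torusMeasure)
      (∫ θ, (weight h θ * Φ θ).trace ∂torusMeasure) := by
  have hss : Summable fun p : ℤ × ℤ => entrySum (h p.1) * entrySum (h p.2) :=
    summable_prod_mul_of_nonneg (f := fun t => entrySum (h t)) hs fun _ => entrySum_nonneg _
  set G : ℤ × ℤ → Torus → ℂ := fun p θ => ∑ i, ∑ j, ∑ k, ((h p.1 k i * h p.2 k j : ℝ) : ℂ) *
      (fourier (p.1 - p.2) θ * Φ θ j i) with hG
  have hterm : ∀ (p : ℤ × ℤ) i j k, Integrable (fun θ => ((h p.1 k i * h p.2 k j : ℝ) : ℂ) *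
      (fourier (p.1 - p.2) θ * Φ θ j i)) torusMeasure := fun p i j k =>
    (integrable_fourier_mul (hΦ j i) _).const_mul _
  have hGi : ∀ p, Integrable (G p) torusMeasure := fun p =>
    integrable_finsetSum _ fun i _ => integrable_finsetSum _ fun j _ =>
      integrable_finsetSum _ fun k _ => hterm p i j k
  have hGs : Summable fun p => ∫ θ, ‖G p θ‖ ∂torusMeasure := by
    refine Summable.of_nonneg_of_le (fun p => integral_nonneg fun ω => norm_nonneg _) (fun p => ?_)
      (hss.mul_right (∑ i, ∑ j, ∑ _k : Fin m, ∫ θ, ‖Φ θ j i‖ ∂torusMeasure))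
    have hb : Integrable (fun θ => (entrySum (h p.1) * entrySum (h p.2)) *
        ∑ i, ∑ j, ∑ _k : Fin m, ‖Φ θ j i‖) torusMeasure :=
      (integrable_finsetSum _ fun i _ => integrable_finsetSum _ fun j _ =>
        integrable_finsetSum _ fun k _ => (hΦ j i).norm).const_mul _
    calc ∫ θ, ‖G p θ‖ ∂torusMeasure
        ≤ ∫ θ, (entrySum (h p.1) * entrySum (h p.2)) *
            ∑ i, ∑ j, ∑ _k : Fin m, ‖Φ θ j i‖ ∂torusMeasure := by
          refine integral_mono (hGi p).norm hb fun θ => ?_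
          simp only [hG, Finset.mul_sum]
          refine norm_sum_le_of_le _ fun i _ => norm_sum_le_of_le _ fun j _ =>
            norm_sum_le_of_le _ fun k _ => ?_
          rw [norm_mul, norm_mul, norm_fourier_apply, one_mul, Complex.norm_real, norm_mul]
          exact mul_le_mul_of_nonneg_right (mul_le_mul (abs_le_entrySum _ _ _)
            (abs_le_entrySum _ _ _) (abs_nonneg _) (entrySum_nonneg _)) (norm_nonneg _)
      _ = _ := by
          rw [integral_const_mul, integral_finsetSum _ fun i _ => integrable_finsetSum _ fun j _ =>
            integrable_finsetSum _ fun k _ => (hΦ j i).norm]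
          simp_rw [integral_finsetSum _ fun j _ =>
            integrable_finsetSum _ fun k _ => (hΦ j _).norm, integral_finsetSum _ fun k _ =>
              (hΦ _ _).norm]
  have hT := hasSum_integral_of_summable_integral_norm hGi hGs
  have hGt : ∀ θ, ∑' p, G p θ = (weight h θ * Φ θ).trace := fun θ =>
    (hasSum_trace_weight hs (Φ θ) θ).tsum_eq
  simp_rw [hGt] at hT
  refine hT.congr_fun fun p => ?_
  simp only [hG]
  rw [integral_finsetSum _ fun i _ => integrable_finsetSum _ fun j _ =>
      integrable_finsetSum _ fun k _ => hterm p i j k]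
  refine Finset.sum_congr rfl fun i _ => ?_
  rw [integral_finsetSum _ fun j _ => integrable_finsetSum _ fun k _ => hterm p i j k]
  refine Finset.sum_congr rfl fun j _ => ?_
  rw [integral_finsetSum _ fun k _ => hterm p i j k]
  exact Finset.sum_congr rfl fun k _ => (integral_const_mul _ _).symm

/-- A square integrable process `z` with spectral density `Φ`, filtered by a summable impulse
response `h`: the output exists and its second moment is `∫ tr(Ω Φ)`. -/
theorem conv_second_moment {Ω : Type*} [MeasurableSpace Ω] {P : Measure Ω} [IsProbabilityMeasure P]
    {m : ℕ} {z : ℤ → Ω → Vec m} (hz : ∀ t, MemLp (z t) 2 P) {Φ : Torus → CMat m}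
    (hΦ : TorusIntegrable Φ)
    (hcov : ∀ (t k : ℤ) (i j : Fin m),
      ∫ ω, z (t + k) ω i * z t ω j ∂P = (∫ θ, fourier k θ * Φ θ i j ∂torusMeasure).re)
    {h : ℤ → Matrix (Fin m) (Fin m) ℝ} (hs : Summable fun t => entrySum (h t)) (t : ℤ) :
    (∀ᵐ ω ∂P, ConvConverges h (fun s => z s ω) t) ∧
    Integrable (fun ω => ‖conv h (fun s => z s ω) t‖ ^ 2) P ∧
    ∫ ω, ‖conv h (fun s => z s ω) t‖ ^ 2 ∂P =
      (∫ θ, (weight h θ * Φ θ).trace ∂torusMeasure).re := by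
  have hprod : ∀ s r i j, Integrable (fun ω => z s ω i * z r ω j) P := fun s r i j =>
    (MemLp.euclidean_apply (hz s) i).integrable_mul (MemLp.euclidean_apply (hz r) j)
  set C : ℝ := ∑ i, (∫ θ, fourier 0 θ * Φ θ i i ∂torusMeasure).re with hC
  have hzC : ∀ s, ∫ ω, ‖z s ω‖ ^ 2 ∂P = C := fun s => by
    simp_rw [EuclideanSpace.real_norm_sq_eq]
    rw [integral_finsetSum _ fun i _ => by simpa only [sq] using hprod s s i i, hC]
    refine Finset.sum_congr rfl fun i _ => ?_
    rw [← hcov s 0 i i, add_zero]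
    simp_rw [sq]
  have hC0 : 0 ≤ C := hzC 0 ▸ integral_nonneg fun ω => by positivity
  set a : ℤ → Ω → Vec m := fun s ω => Matrix.toEuclideanLin (h s) (z (t - s) ω) with ha
  have ha2 : ∀ s, MemLp (a s) 2 P := fun s =>
    (LinearMap.toContinuousLinearMap (Matrix.toEuclideanLin (h s))).comp_memLp' (hz (t - s))
  -- absolute convergence
  have hsum1 : ∀ᵐ ω ∂P, Summable fun s => ‖a s ω‖ := by
    refine (ae_summable_norm_of_summable_integral_norm
      (fun s => (ha2 s).integrable (by norm_num)) ?_).1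
    refine Summable.of_nonneg_of_le (fun s => integral_nonneg fun ω => norm_nonneg _) (fun s => ?_)
      (hs.mul_right (max C 1))
    have hz2 := (hz (t - s)).integrable_norm_pow (p := 2) (by norm_num)
    -- The bound `u ≤ (u² + 1) / 2` controls the first moment by the second moment `C`, which is the
    -- same at all times; `max C 1` dominates `(C + 1) / 2`.
    calc ∫ ω, ‖a s ω‖ ∂P ≤ ∫ ω, entrySum (h s) * ((‖z (t - s) ω‖ ^ 2 + 1) / 2) ∂P := by
          refine integral_mono ((ha2 s).integrable (by norm_num)).norm
            (((hz2.add (integrable_const 1)).div_const 2).const_mul _) fun ω => ?_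
          refine (norm_toEuclideanLin_le _ _).trans
            (mul_le_mul_of_nonneg_left ?_ (entrySum_nonneg _))
          change ‖z (t - s) ω‖ ≤ (‖z (t - s) ω‖ ^ 2 + 1) / 2
          nlinarith [sq_nonneg (‖z (t - s) ω‖ - 1)]
      _ ≤ entrySum (h s) * max C 1 := by
          rw [integral_const_mul, integral_div, integral_add hz2 (integrable_const 1), hzC]
          refine mul_le_mul_of_nonneg_left ?_ (entrySum_nonneg _)
          have := le_max_left C 1
          have := le_max_right C 1
          simp only [integral_const, probReal_univ, smul_eq_mul, mul_one]
          linarith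
  have hss : Summable fun p : ℤ × ℤ => entrySum (h p.1) * entrySum (h p.2) :=
    summable_prod_mul_of_nonneg (f := fun t => entrySum (h t)) hs fun _ => entrySum_nonneg _
  -- the double series under the expectation
  have hFi : ∀ p : ℤ × ℤ, Integrable (fun ω => inner ℝ (a p.1 ω) (a p.2 ω)) P := fun p =>
    (integral_norm_mul_norm_le (ha2 p.1) (ha2 p.2) (le_max_left _ _) (le_max_right _ _) |>.1 |> fun hi =>
      hi.mono ((ha2 p.1).1.inner (ha2 p.2).1) (Filter.Eventually.of_forall fun ω => by
        simpa using abs_real_inner_le_norm (a p.1 ω) (a p.2 ω)))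
  have hFs : Summable fun p : ℤ × ℤ => ∫ ω, ‖(inner ℝ (a p.1 ω) (a p.2 ω) : ℝ)‖ ∂P := by
    refine Summable.of_nonneg_of_le (fun p => integral_nonneg fun ω => norm_nonneg _) (fun p => ?_)
      (hss.mul_right C)
    have h1 := integral_norm_mul_norm_le (hz (t - p.1)) (hz (t - p.2)) (hzC _).le (hzC _).le
    calc ∫ ω, ‖(inner ℝ (a p.1 ω) (a p.2 ω) : ℝ)‖ ∂P
        ≤ ∫ ω, (entrySum (h p.1) * entrySum (h p.2)) *
            (‖z (t - p.1) ω‖ * ‖z (t - p.2) ω‖) ∂P := by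
          refine integral_mono (hFi p).norm (h1.1.const_mul _) fun ω => ?_
          calc ‖(inner ℝ (a p.1 ω) (a p.2 ω) : ℝ)‖ ≤ ‖a p.1 ω‖ * ‖a p.2 ω‖ :=
                norm_inner_le_norm _ _
            _ ≤ (entrySum (h p.1) * ‖z (t - p.1) ω‖) * (entrySum (h p.2) * ‖z (t - p.2) ω‖) :=
                mul_le_mul (norm_toEuclideanLin_le _ _) (norm_toEuclideanLin_le _ _)
                  (norm_nonneg _) (mul_nonneg (entrySum_nonneg _) (norm_nonneg _))
            _ = _ := by ring
      _ ≤ _ := by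
          rw [integral_const_mul]
          exact mul_le_mul_of_nonneg_left h1.2
            (mul_nonneg (entrySum_nonneg _) (entrySum_nonneg _))
  have hae : ∀ᵐ ω ∂P, ‖conv h (fun s => z s ω) t‖ ^ 2 =
      ∑' p : ℤ × ℤ, inner ℝ (a p.1 ω) (a p.2 ω) := by
    filter_upwards [hsum1] with ω hω using (hasSum_inner_prod hω).tsum_eq.symm
  obtain ⟨hF1, hF2⟩ := ae_summable_norm_of_summable_integral_norm hFi hFs
  have hInt : Integrable (fun ω => ‖conv h (fun s => z s ω) t‖ ^ 2) P := by
    refine Integrable.congr ?_ (hae.mono fun ω hω => hω.symm)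
    refine hF2.mono (AEMeasurable.aestronglyMeasurable
      (AEMeasurable.tsum fun p => (hFi p).1.aemeasurable)) ?_
    filter_upwards [hF1] with ω hω
    exact (norm_tsum_le_tsum_norm hω).trans (le_abs_self _)
  refine ⟨hsum1.mono fun ω hω => hω.of_norm, hInt, ?_⟩
  have hE := hasSum_integral_of_summable_integral_norm hFi hFs
  rw [← integral_congr_ae hae] at hE
  -- Time domain and frequency domain give double series with the same real weights, so they are
  -- compared term by term after taking real parts. Only the real parts of the Fourier coefficients
  -- of `Φ` enter.
  refine hE.unique ((Complex.hasSum_re (hasSum_integral_trace_weight hΦ hs)).congr_fun fun p => ?_)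
  have e1 : ∀ ω, (inner ℝ (a p.1 ω) (a p.2 ω) : ℝ) = ∑ i, ∑ j, ∑ k,
      (h p.1 k i * h p.2 k j) * (z (t - p.2) ω j * z (t - p.1) ω i) := fun ω => by
    simp only [ha, inner_toEuclideanLin]
  have hterm : ∀ i j k, Integrable (fun ω => (h p.1 k i * h p.2 k j) *
      (z (t - p.2) ω j * z (t - p.1) ω i)) P := fun i j k => (hprod _ _ _ _).const_mul _
  simp_rw [e1]
  rw [integral_finsetSum _ fun i _ => integrable_finsetSum _ fun j _ =>
    integrable_finsetSum _ fun k _ => hterm i j k, Complex.re_sum]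
  refine Finset.sum_congr rfl fun i _ => ?_
  rw [integral_finsetSum _ fun j _ =>
    integrable_finsetSum _ fun k _ => hterm i j k, Complex.re_sum]
  refine Finset.sum_congr rfl fun j _ => ?_
  rw [integral_finsetSum _ fun k _ => hterm i j k, Complex.re_sum]
  refine Finset.sum_congr rfl fun k _ => ?_
  rw [integral_const_mul, Complex.re_ofReal_mul, ← hcov (t - p.1),
    show t - p.1 + (p.1 - p.2) = t - p.2 by ring]

/-! ### Spectral densities from covariances, and their positivity -/

/-- A square summable sequence is the sequence of Fourier coefficients of an `L²` function. -/
theorem exists_memLp_integral_fourier_eq {c : ℤ → ℂ} (hc : Summable fun k => ‖c k‖ ^ 2) :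
    ∃ g : Torus → ℂ, MemLp g 2 torusMeasure ∧
      ∀ k, ∫ θ, fourier k θ * g θ ∂torusMeasure = c k := by
  -- `fourierCoeff` integrates against `e^{-ikϑ}`, whereas covariances use `e^{ikϑ}`; hence the
  -- reversed sequence.
  have hmem : Memℓp (fun k => c (-k)) 2 := by
    refine memℓp_gen ?_
    simpa [Function.comp_def] using (Equiv.neg ℤ).summable_iff.2 hc
  set g := (fourierBasis (T := 2 * Real.pi)).repr.symm ⟨_, hmem⟩ with hg
  refine ⟨g, Lp.memLp g, fun k => ?_⟩
  have h1 : fourierBasis.repr g (-k) = c k := by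
    rw [hg, LinearIsometryEquiv.apply_symm_apply]
    exact congrArg c (neg_neg k)
  rw [fourierBasis_repr, fourierCoeff] at h1
  simpa using h1

/-- Inner regularity by closed sets of the finite measure with density `|g|`: on a measurable set,
the integral of `g` differs by at most `ε` from its integral over a closed subset. -/
theorem ae_nonneg_of_forall_isClosed {X : Type*} [TopologicalSpace X] [MeasurableSpace X]
    [BorelSpace X] [TopologicalSpace.PseudoMetrizableSpace X] {μ : Measure X}
    {g : X → ℝ} (hg : Integrable g μ) (h : ∀ K, IsClosed K → 0 ≤ ∫ x in K, g x ∂μ) :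
    0 ≤ᵐ[μ] g := by
  refine ae_nonneg_of_forall_setIntegral_nonneg hg fun s hs _ => ?_
  refine le_of_forall_pos_le_add fun ε hε => ?_
  set ν := μ.withDensity fun x => ‖g x‖ₑ
  have : IsFiniteMeasure ν := isFiniteMeasure_withDensity hg.2.ne
  obtain ⟨K, hKs, hK, hlt⟩ := hs.exists_isClosed_sdiff_lt (μ := ν) (measure_ne_top _ _)
    (ENNReal.ofReal_pos.2 hε).ne'
  rw [withDensity_apply _ (hs.diff hK.measurableSet)] at hlt
  have h1 : ∫ x in s, g x ∂μ = ∫ x in K, g x ∂μ + ∫ x in s \ K, g x ∂μ := by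
    rw [← setIntegral_union Set.disjoint_sdiff_right (hs.diff hK.measurableSet)
      hg.integrableOn hg.integrableOn, Set.union_sdiff_cancel hKs]
  have h2 : ‖∫ x in s \ K, g x ∂μ‖ ≤ ε := by
    refine (norm_integral_le_integral_norm _).trans ?_
    rw [integral_norm_eq_lintegral_enorm hg.1.restrict]
    exact ENNReal.toReal_le_of_le_ofReal hε.le hlt.le
  have h3 := neg_le_of_abs_le h2
  have h4 := h K hK
  linarith

/-- The indicator of a closed set is a pointwise limit of continuous functions with values in `[0,
1]`, and so is its square; dominated convergence passes the inequality to closed sets. -/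
theorem ae_nonneg_of_forall_continuous {X : Type*} [TopologicalSpace X] [MeasurableSpace X]
    [BorelSpace X] [TopologicalSpace.PseudoMetrizableSpace X] {μ : Measure X}
    {g : X → ℝ} (hg : Integrable g μ) (h : ∀ φ : C(X, ℂ), 0 ≤ ∫ x, ‖φ x‖ ^ 2 * g x ∂μ) :
    0 ≤ᵐ[μ] g := by
  refine ae_nonneg_of_forall_isClosed hg fun K hK => ?_
  set φ : ℕ → C(X, ℂ) := fun n =>
    ⟨fun x => ((hK.apprSeq n x : ℝ) : ℂ), by fun_prop⟩
  have hφ : ∀ n x, ‖φ n x‖ = hK.apprSeq n x := fun n x => by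
    simp [φ, Complex.norm_real]
  have hle : ∀ n x, ‖φ n x‖ ≤ 1 := fun n x => by
    rw [hφ]; exact_mod_cast HasOuterApproxClosed.apprSeq_apply_le_one hK n x
  have hlim : Filter.Tendsto (fun n => ∫ x, ‖φ n x‖ ^ 2 * g x ∂μ) Filter.atTop
      (nhds (∫ x, K.indicator g x ∂μ)) := by
    refine tendsto_integral_of_dominated_convergence (fun x => ‖g x‖) (fun n => ?_) hg.norm
      (fun n => Filter.Eventually.of_forall fun x => ?_) (Filter.Eventually.of_forall fun x => ?_)
    · exact ((φ n).continuous.norm.pow 2).aestronglyMeasurable.mul hg.1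
    · rw [norm_mul, norm_pow, norm_norm]
      exact mul_le_of_le_one_left (norm_nonneg _) (pow_le_one₀ (norm_nonneg _) (hle n x))
    · have h1 := (tendsto_pi_nhds.1 (HasOuterApproxClosed.tendsto_apprSeq hK)) x
      have h2 : Filter.Tendsto (fun n => ((hK.apprSeq n x : NNReal) : ℝ)) Filter.atTop
          (nhds ((K.indicator (fun _ => (1 : NNReal)) x : NNReal) : ℝ)) :=
        (NNReal.continuous_coe.tendsto _).comp h1
      simp_rw [hφ]
      convert (h2.pow 2).mul_const (g x) using 2
      by_cases hx : x ∈ K <;> simp [hx]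
  rw [← integral_indicator hK.measurableSet]
  exact ge_of_tendsto' hlim fun n => h (φ n)

/-- An integrable function on the circle whose integrals against all `|q|²`, `q` a trigonometric
polynomial, are nonnegative is nonnegative. -/
theorem ae_nonneg_of_forall_trigPoly {g : Torus → ℝ} (hg : Integrable g torusMeasure)
    (h : ∀ a : ℤ →₀ ℂ, 0 ≤ ∫ θ, ‖∑ n ∈ a.support, a n * fourier n θ‖ ^ 2 * g θ ∂torusMeasure) :
    0 ≤ᵐ[torusMeasure] g := by
  refine ae_nonneg_of_forall_continuous hg fun φ => ?_
  -- Continuity in the uniform norm lets the inequality extend from trigonometric polynomials to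
  -- their closure, which is all of `C(Torus, ℂ)`.
  have hcont : Continuous fun φ : C(Torus, ℂ) => ∫ θ, ‖φ θ‖ ^ 2 * g θ ∂torusMeasure := by
    refine continuous_iff_continuousAt.2 fun φ => ?_
    refine continuousAt_of_dominated (bound := fun θ => (‖φ‖ + 1) ^ 2 * ‖g θ‖)
      (Filter.Eventually.of_forall fun ψ =>
        (ψ.continuous.norm.pow 2).aestronglyMeasurable.mul hg.1) ?_ (hg.norm.const_mul _)
      (Filter.Eventually.of_forall fun θ => ?_)
    · filter_upwards [Metric.ball_mem_nhds φ one_pos] with ψ hψ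
      refine Filter.Eventually.of_forall fun θ => ?_
      rw [norm_mul, norm_pow, norm_norm]
      refine mul_le_mul_of_nonneg_right (pow_le_pow_left₀ (norm_nonneg _) ?_ 2) (norm_nonneg _)
      refine (ψ.norm_coe_le_norm θ).trans ?_
      have h1 : ‖ψ - φ‖ < 1 := by rwa [← dist_eq_norm]
      have := norm_le_norm_add_norm_sub' ψ φ
      linarith
    · exact (((continuous_eval_const θ).norm.pow 2).mul continuous_const).continuousAt
  have hclosed : IsClosed {φ : C(Torus, ℂ) | 0 ≤ ∫ θ, ‖φ θ‖ ^ 2 * g θ ∂torusMeasure} :=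
    isClosed_le continuous_const hcont
  have hspan : (Submodule.span ℂ (Set.range (fourier (T := 2 * Real.pi))) : Set C(Torus, ℂ)) ⊆
      {φ : C(Torus, ℂ) | 0 ≤ ∫ θ, ‖φ θ‖ ^ 2 * g θ ∂torusMeasure} := by
    intro ψ hψ
    obtain ⟨a, rfl⟩ := Finsupp.mem_span_range_iff_exists_finsupp.1 hψ
    have := h a
    simpa [Finsupp.sum] using this
  have hmem : φ ∈ (Submodule.span ℂ (Set.range (fourier (T := 2 * Real.pi)))).topologicalClosure := by
    rw [span_fourier_closure_eq_top]
    trivial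
  exact hclosed.closure_subset_iff.2 hspan hmem

/-- The spectral density matrix of a stationary covariance function is positive semidefinite. -/
theorem ae_posSemidef_of_covariance {Ω A : Type*} [MeasurableSpace Ω] {P : Measure Ω} [Fintype A]
    {W : ℤ → A → Ω → ℝ} (hW : ∀ t a, MemLp (W t a) 2 P) {F : Torus → Matrix A A ℂ}
    (hF : ∀ a b, Integrable (fun θ => F θ a b) torusMeasure)
    (hH : ∀ᵐ θ ∂torusMeasure, (F θ).IsHermitian)
    (hcov : ∀ (s t : ℤ) (a b : A), ((∫ ω, W s a ω * W t b ω ∂P : ℝ) : ℂ) =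
      ∫ θ, fourier (s - t) θ * F θ a b ∂torusMeasure) :
    ∀ᵐ θ ∂torusMeasure, (F θ).PosSemidef := by
  set Q : (A → ℂ) → Torus → ℂ := fun v θ => dotProduct (star v) ((F θ).mulVec v) with hQ
  have hQe : ∀ v θ, Q v θ = ∑ a, ∑ b, star (v a) * v b * F θ a b := fun v θ => by
    simp only [hQ, dotProduct, Matrix.mulVec, Finset.mul_sum, Pi.star_apply]
    exact Finset.sum_congr rfl fun a _ => Finset.sum_congr rfl fun b _ => by ring
  have hQi : ∀ v, Integrable (Q v) torusMeasure := fun v => by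
    rw [show Q v = fun θ => ∑ a, ∑ b, star (v a) * v b * F θ a b from funext (hQe v)]
    exact integrable_finsetSum _ fun a _ => integrable_finsetSum _ fun b _ =>
      (hF a b).const_mul _
  have key : ∀ v, ∀ᵐ θ ∂torusMeasure, 0 ≤ (Q v θ).re := by
    intro v
    refine ae_nonneg_of_forall_trigPoly (hQi v).re fun q => ?_
    -- the quadratic form is the second moment of a linear combination
    set I : Finset (ℤ × A) := q.support ×ˢ Finset.univ
    set κ : ℤ × A → ℂ := fun p => q p.1 * star (v p.2)
    have hWW : ∀ p p' : ℤ × A, Integrable (fun ω => ((W p.1 p.2 ω * W p'.1 p'.2 ω : ℝ) : ℂ)) P :=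
      fun p p' => ((hW p.1 p.2).integrable_mul (hW p'.1 p'.2)).ofReal
    have hsq : ∀ ω, ((‖∑ p ∈ I, κ p * (W p.1 p.2 ω : ℂ)‖ ^ 2 : ℝ) : ℂ) =
        ∑ p ∈ I, ∑ p' ∈ I, κ p * star (κ p') * ((W p.1 p.2 ω * W p'.1 p'.2 ω : ℝ) : ℂ) := by
      intro ω
      rw [Complex.ofReal_pow, ← Complex.mul_conj', map_sum, Finset.sum_mul_sum]
      refine Finset.sum_congr rfl fun p _ => Finset.sum_congr rfl fun p' _ => ?_
      rw [map_mul, Complex.conj_ofReal, Complex.ofReal_mul]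
      simp only [RCLike.star_def]
      ring
    have hpoly : ∀ θ, ((‖∑ n ∈ q.support, q n * fourier n θ‖ ^ 2 : ℝ) : ℂ) * Q v θ =
        ∑ p ∈ I, ∑ p' ∈ I, κ p * star (κ p') * (fourier (p.1 - p'.1) θ * F θ p.2 p'.2) := by
      intro θ
      rw [Complex.ofReal_pow, ← Complex.mul_conj', map_sum, Finset.sum_mul_sum, hQe]
      simp only [I, Finset.sum_product, κ]
      rw [Finset.sum_mul]
      refine Finset.sum_congr rfl fun n _ => ?_
      rw [Finset.sum_mul_sum, Finset.sum_comm]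
      refine Finset.sum_congr rfl fun a _ => Finset.sum_congr rfl fun n' _ => ?_
      rw [Finset.mul_sum]
      refine Finset.sum_congr rfl fun b _ => ?_
      rw [sub_eq_add_neg, fourier_add, ← star_fourier, map_mul, star_mul', star_star]
      simp only [RCLike.star_def]
      ring
    have hIE : (∫ ω, ((‖∑ p ∈ I, κ p * (W p.1 p.2 ω : ℂ)‖ ^ 2 : ℝ) : ℂ) ∂P) =
        ∫ θ, ((‖∑ n ∈ q.support, q n * fourier n θ‖ ^ 2 : ℝ) : ℂ) * Q v θ ∂torusMeasure := by
      simp_rw [hsq, hpoly]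
      rw [integral_finsetSum _ fun p _ => integrable_finsetSum _ fun p' _ =>
          (hWW p p').const_mul _,
        integral_finsetSum _ fun p _ => integrable_finsetSum _ fun p' _ =>
          (integrable_fourier_mul (hF p.2 p'.2) _).const_mul _]
      refine Finset.sum_congr rfl fun p _ => ?_
      rw [integral_finsetSum _ fun p' _ => (hWW p p').const_mul _,
        integral_finsetSum _ fun p' _ => (integrable_fourier_mul (hF p.2 p'.2) _).const_mul _]
      refine Finset.sum_congr rfl fun p' _ => ?_
      rw [integral_const_mul, integral_const_mul, ← hcov, integral_complex_ofReal]
    rw [integral_complex_ofReal] at hIE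
    have hre := congrArg Complex.re hIE
    rw [Complex.ofReal_re, ← RCLike.re_eq_complex_re, ← integral_re] at hre
    · simp only [RCLike.re_eq_complex_re, Complex.re_ofReal_mul] at hre
      change 0 ≤ ∫ θ, ‖∑ n ∈ q.support, q n * fourier n θ‖ ^ 2 * (Q v θ).re ∂torusMeasure
      rw [← hre]
      exact integral_nonneg fun ω => by positivity
    · simp_rw [hpoly]
      exact integrable_finsetSum _ fun p _ => integrable_finsetSum _ fun p' _ =>
          (integrable_fourier_mul (hF p.2 p'.2) _).const_mul _
  -- The exceptional null set in `key` depends on `v`. A countable dense family gives a common one,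
  -- and continuity of the quadratic form in `v` covers the rest.
  filter_upwards [ae_all_iff.2 fun n => key (TopologicalSpace.denseSeq (A → ℂ) n), hH] with θ hθ hHθ
  refine Matrix.PosSemidef.of_dotProduct_mulVec_nonneg hHθ fun v => ?_
  have h1 : 0 ≤ (Q v θ).re := by
    have hcl : IsClosed {v : A → ℂ | 0 ≤ (Q v θ).re} := by
      refine isClosed_le continuous_const ?_
      simp_rw [hQe]
      fun_prop
    exact hcl.closure_subset_iff.2 (Set.range_subset_iff.2 hθ)
      (TopologicalSpace.denseRange_denseSeq _ v)
  have h2 : (Q v θ).im = 0 := by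
    simpa using hHθ.im_star_dotProduct_mulVec_self v
  exact Complex.nonneg_iff.2 ⟨h1, h2.symm⟩

/-! ### Centred Gaussian processes: uniqueness in law and existence -/

theorem charFunDual_gaussian_pi {Ω ι : Type*} [MeasurableSpace Ω] [Fintype ι] {P : Measure Ω}
    {U : ι → Ω → ℝ} (hU : HasGaussianLaw (fun ω i => U i ω) P) (h0 : ∀ i, ∫ ω, U i ω ∂P = 0)
    (L : StrongDual ℝ (ι → ℝ)) :
    charFunDual (P.map fun ω i => U i ω) L =
      Complex.exp (-((∑ i, ∑ j, L (Pi.basisFun ℝ ι i) * L (Pi.basisFun ℝ ι j) *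
        ∫ ω, U i ω * U j ω ∂P : ℝ) : ℂ) / 2) := by
  have : IsProbabilityMeasure P := hU.isProbabilityMeasure
  have hm : ∀ i, MemLp (U i) 2 P := fun i => (hU.eval i).memLp_two
  have hL : ∀ ω, L (fun i => U i ω) = ∑ i, L (Pi.basisFun ℝ ι i) * U i ω := fun ω => by
    conv_lhs => rw [← (Pi.basisFun ℝ ι).sum_repr (fun i => U i ω)]
    simp [mul_comm]
  have hmean : ∫ ω, L (fun i => U i ω) ∂P = 0 := by
    simp_rw [hL]
    rw [integral_finsetSum _ fun i _ => ((hm i).integrable (by norm_num)).const_mul _]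
    simp [integral_const_mul, h0]
  have hvar : Var[fun ω => L (fun i => U i ω); P] = ∑ i, ∑ j, L (Pi.basisFun ℝ ι i) *
      L (Pi.basisFun ℝ ι j) * ∫ ω, U i ω * U j ω ∂P := by
    rw [variance_of_integral_eq_zero (hU.map_fun L).aemeasurable hmean]
    simp_rw [hL, sq, Finset.sum_mul_sum]
    have hi : ∀ i j, Integrable (fun ω => L (Pi.basisFun ℝ ι i) * U i ω *
        (L (Pi.basisFun ℝ ι j) * U j ω)) P := fun i j =>
      ((hm i).const_mul _).integrable_mul ((hm j).const_mul _)
    rw [integral_finsetSum _ fun i _ => integrable_finsetSum _ fun j _ => hi i j]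
    refine Finset.sum_congr rfl fun i _ => ?_
    rw [integral_finsetSum _ fun j _ => hi i j]
    refine Finset.sum_congr rfl fun j _ => ?_
    rw [← integral_const_mul]
    congr with ω
    ring
  rw [hU.charFunDual_map_eq_fun, hmean, hvar]
  simp [neg_div]

theorem map_gaussian_pi_eq {Ω Ω' ι : Type*} [MeasurableSpace Ω] [MeasurableSpace Ω'] [Finite ι]
    {P : Measure Ω} {P' : Measure Ω'} {U : ι → Ω → ℝ} {U' : ι → Ω' → ℝ}
    (hU : HasGaussianLaw (fun ω i => U i ω) P) (hU' : HasGaussianLaw (fun ω i => U' i ω) P')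
    (h0 : ∀ i, ∫ ω, U i ω ∂P = 0) (h0' : ∀ i, ∫ ω, U' i ω ∂P' = 0)
    (h : ∀ i j, ∫ ω, U i ω * U j ω ∂P = ∫ ω, U' i ω * U' j ω ∂P') :
    P.map (fun ω i => U i ω) = P'.map (fun ω i => U' i ω) := by
  have := Fintype.ofFinite ι
  have : IsProbabilityMeasure P := hU.isProbabilityMeasure
  have : IsProbabilityMeasure P' := hU'.isProbabilityMeasure
  apply Measure.ext_of_charFunDual
  ext L
  rw [charFunDual_gaussian_pi hU h0, charFunDual_gaussian_pi hU' h0']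
  simp_rw [h]

/-- Two centred real Gaussian processes with the same covariance have the same law. -/
theorem map_gaussianProcess_eq {Ω Ω' ι : Type*} [MeasurableSpace Ω] [MeasurableSpace Ω']
    {P : Measure Ω} {P' : Measure Ω'} {U : ι → Ω → ℝ} {U' : ι → Ω' → ℝ}
    (hU : IsGaussianProcess U P) (hU' : IsGaussianProcess U' P')
    (hm : AEMeasurable (fun ω i => U i ω) P) (hm' : AEMeasurable (fun ω i => U' i ω) P')
    (h0 : ∀ i, ∫ ω, U i ω ∂P = 0) (h0' : ∀ i, ∫ ω, U' i ω ∂P' = 0)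
    (h : ∀ i j, ∫ ω, U i ω * U j ω ∂P = ∫ ω, U' i ω * U' j ω ∂P') :
    P.map (fun ω i => U i ω) = P'.map (fun ω i => U' i ω) := by
  have : IsProbabilityMeasure P := hU.isProbabilityMeasure
  have : IsProbabilityMeasure P' := hU'.isProbabilityMeasure
  -- Both laws are projective limits of their finite-dimensional marginals, so it suffices that
  -- these marginals agree.
  have e := isProjectiveLimit_map (X := U) hm
  have e' := isProjectiveLimit_map (X := U') hm'
  have : (fun I : Finset ι => P.map fun ω => I.restrict (U · ω)) =
      fun I => P'.map fun ω => I.restrict (U' · ω) := by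
    ext1 I
    exact map_gaussian_pi_eq (ι := I) (U := fun i => U i) (U' := fun i => U' i)
      (hU.hasGaussianLaw I) (hU'.hasGaussianLaw I) (fun i => h0 i) (fun i => h0' i)
      (fun i j => h i j)
  rw [this] at e
  exact e.unique e'

/-- The law of a sequence of independent standard Gaussian variables. -/
def whiteNoise : Measure (ℕ → ℝ) := Measure.infinitePi fun _ => gaussianReal 0 1

instance : IsProbabilityMeasure whiteNoise := by unfold whiteNoise; infer_instance

theorem isGaussianProcess_whiteNoise :
    IsGaussianProcess (fun (n : ℕ) (x : ℕ → ℝ) => x n) whiteNoise := by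
  refine ⟨fun I => ?_⟩
  have h1 : iIndepFun (fun (n : ℕ) (x : ℕ → ℝ) => x n) whiteNoise :=
    iIndepFun_infinitePi (P := fun _ : ℕ => gaussianReal 0 1) (X := fun _ x => x)
      fun _ => measurable_id
  have h2 : iIndepFun (fun (n : I) (x : ℕ → ℝ) => x n) whiteNoise :=
    h1.precomp Subtype.val_injective
  refine h2.hasGaussianLaw fun n => ⟨?_⟩
  rw [show (fun ω : ℕ → ℝ => I.restrict (fun x => ω x) n) = fun x => x n from rfl, whiteNoise,
    Measure.infinitePi_map_eval]
  infer_instance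

theorem integral_whiteNoise (n : ℕ) : ∫ x, x n ∂whiteNoise = 0 := by
  have h := integral_map (μ := whiteNoise) (φ := fun x : ℕ → ℝ => x n) (f := id)
    (measurable_pi_apply n).aemeasurable (by fun_prop)
  rw [whiteNoise, Measure.infinitePi_map_eval] at h
  rw [whiteNoise]
  simpa using h.symm

theorem integral_whiteNoise_mul (n k : ℕ) :
    ∫ x, x n * x k ∂whiteNoise = if n = k then 1 else 0 := by
  split_ifs with hnk
  · subst hnk
    have h := integral_map (μ := whiteNoise) (φ := fun x : ℕ → ℝ => x n) (f := fun y => y ^ 2)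
      (measurable_pi_apply n).aemeasurable (by fun_prop)
    have h1 := variance_of_integral_eq_zero (X := id) (μ := gaussianReal 0 1) aemeasurable_id
      (by simp)
    rw [variance_id_gaussianReal] at h1
    rw [whiteNoise, Measure.infinitePi_map_eval] at h
    rw [whiteNoise]
    simp only [id, NNReal.coe_one] at h1
    simp_rw [← sq]
    rw [← h, ← h1]
  · have h1 : iIndepFun (fun (n : ℕ) (x : ℕ → ℝ) => x n) whiteNoise :=
      iIndepFun_infinitePi (P := fun _ : ℕ => gaussianReal 0 1) (X := fun _ x => x)
        fun _ => measurable_id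
    have := (h1.indepFun hnk).integral_fun_mul_eq_mul_integral
      (measurable_pi_apply n).aestronglyMeasurable (measurable_pi_apply k).aestronglyMeasurable
    rw [this, integral_whiteNoise, zero_mul]

/-- Gram–Schmidt makes each vector a finite combination of an orthonormal system. The Gram matrix
thus factors through finitely supported rows, and finite sums of white noise can realise it with no
convergence question. -/
theorem exists_gram_factor {E : Type*} [NormedAddCommGroup E] [InnerProductSpace ℝ E]
    (v : ℕ → E) : ∃ c : ℕ → ℕ →₀ ℝ, ∀ i j,
      (inner ℝ (v i) (v j) : ℝ) = (c i).sum fun k a => a * c j k := by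
  classical
  set g := InnerProductSpace.gramSchmidtNormed ℝ v
  have hspan : ∀ i, v i ∈ Submodule.span ℝ (Set.range g) := fun i => by
    rw [InnerProductSpace.span_gramSchmidtNormed_range, InnerProductSpace.span_gramSchmidt]
    exact Submodule.subset_span ⟨i, rfl⟩
  have hg : ∀ k l, g k ≠ 0 → (inner ℝ (g k) (g l) : ℝ) = if k = l then 1 else 0 := by
    intro k l hk
    split_ifs with hkl
    · subst hkl
      rw [real_inner_self_eq_norm_sq, InnerProductSpace.gramSchmidtNormed_unit_length' hk, one_pow]
    · simp only [g, InnerProductSpace.gramSchmidtNormed, inner_smul_left, inner_smul_right,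
        InnerProductSpace.gramSchmidt_orthogonal ℝ v hkl, mul_zero]
  choose c hc using fun i => (Finsupp.mem_span_range_iff_exists_finsupp.1 (hspan i))
  -- Linearly dependent vectors produce zeros in the Gram–Schmidt system. Their coefficients are
  -- dropped so that the remaining directions are orthonormal.
  refine ⟨fun i => (c i).filter fun k => g k ≠ 0, fun i j => ?_⟩
  have hc' : ∀ i, ((c i).filter fun k => g k ≠ 0).sum (fun k a => a • g k) = v i := fun i => by
    rw [← hc i, Finsupp.sum_filter_index, Finsupp.sum, Finsupp.support_filter, Finset.sum_filter]
    refine Finset.sum_congr rfl fun k _ => ?_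
    split_ifs with hk
    · rfl
    · rw [not_not.1 hk, smul_zero]
  conv_lhs => rw [← hc' i, ← hc' j]
  rw [Finsupp.sum, Finsupp.sum, sum_inner]
  refine Finset.sum_congr rfl fun k hk => ?_
  have hk' : g k ≠ 0 := by
    rw [Finsupp.support_filter] at hk
    exact (Finset.mem_filter.1 hk).2
  rw [inner_sum]
  simp only [real_inner_smul_left, real_inner_smul_right, hg k _ hk', mul_ite, mul_one, mul_zero,
    Finset.sum_ite_eq]
  split_ifs with h
  · exact mul_comm _ _
  · simp only [Finsupp.notMem_support_iff.1 h, mul_zero]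

/-- Every countable family of vectors of a real inner product space is the covariance structure
of a centred Gaussian process, defined on the space of sequences. -/
theorem exists_gaussianProcess {ι E : Type*} [Countable ι] [NormedAddCommGroup E]
    [InnerProductSpace ℝ E] (v : ι → E) :
    ∃ W : ι → (ℕ → ℝ) → ℝ, (∀ i, Measurable (W i)) ∧ IsGaussianProcess W whiteNoise ∧
      (∀ i, ∫ x, W i x ∂whiteNoise = 0) ∧
      ∀ i j, ∫ x, W i x * W j x ∂whiteNoise = inner ℝ (v i) (v j) := by
  classical
  have := Encodable.ofCountable ι
  -- Integers that encode no index receive the zero vector.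
  obtain ⟨c, hc⟩ := exists_gram_factor fun n : ℕ => (Encodable.decode (α := ι) n).elim 0 v
  have hx : ∀ n, MemLp (fun x : ℕ → ℝ => x n) 2 whiteNoise := fun n =>
    (isGaussianProcess_whiteNoise.hasGaussianLaw_eval n).memLp_two
  set W : ι → (ℕ → ℝ) → ℝ := fun i x =>
    ∑ k ∈ (c (Encodable.encode i)).support, c (Encodable.encode i) k * x k with hW
  refine ⟨W, fun i => ?_, ?_, fun i => ?_, fun i j => ?_⟩
  · exact Finset.measurable_sum _ fun k _ => (measurable_pi_apply k).const_mul _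
  · refine isGaussianProcess_whiteNoise.of_isGaussianProcess fun i =>
      ⟨(c (Encodable.encode i)).support,
        ∑ k : (c (Encodable.encode i)).support, c (Encodable.encode i) k • ContinuousLinearMap.proj k, fun x => ?_⟩
    simp only [hW, _root_.sum_apply, _root_.smul_apply,
      ContinuousLinearMap.proj_apply, smul_eq_mul, Finset.restrict]
    exact (Finset.sum_coe_sort (c (Encodable.encode i)).support
      fun k => c (Encodable.encode i) k * x k).symm
  · simp only [hW]
    rw [integral_finsetSum _ fun k _ => ((hx k).integrable (by norm_num)).const_mul _]
    simp [integral_const_mul, integral_whiteNoise]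
  · have h1 := hc (Encodable.encode i) (Encodable.encode j)
    simp only [Encodable.encodek, Option.elim_some] at h1
    rw [h1, Finsupp.sum]
    simp only [hW, Finset.sum_mul_sum]
    have hi : ∀ k l, Integrable (fun x : ℕ → ℝ => c (Encodable.encode i) k * x k *
        (c (Encodable.encode j) l * x l)) whiteNoise := fun k l =>
      ((hx k).const_mul _).integrable_mul ((hx l).const_mul _)
    rw [integral_finsetSum _ fun k _ => integrable_finsetSum _ fun l _ => hi k l]
    refine Finset.sum_congr rfl fun k _ => ?_
    rw [integral_finsetSum _ fun l _ => hi k l]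
    have h2 : ∀ l, ∫ x : ℕ → ℝ, c (Encodable.encode i) k * x k *
        (c (Encodable.encode j) l * x l) ∂whiteNoise =
        if k = l then c (Encodable.encode i) k * c (Encodable.encode j) l else 0 := fun l => by
      simp_rw [mul_mul_mul_comm _ _ (c (Encodable.encode j) l) _]
      rw [integral_const_mul, integral_whiteNoise_mul, mul_ite, mul_one, mul_zero]
    simp only [h2, Finset.sum_ite_eq]
    split_ifs with h
    · rfl
    · rw [Finsupp.notMem_support_iff.1 h, mul_zero]

/-! ### Integrability of the spectral quantities -/

section
open Matrix

/-- Writing `M = Sᴴ S`, the entry is the inner product of two columns of `S`, whose squared norms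
are the diagonal entries; then `2uv ≤ u² + v²`. -/
theorem norm_apply_le_of_posSemidef {m : ℕ} {M : CMat m} (hM : M.PosSemidef) (i j : Fin m) :
    ‖M i j‖ ≤ ((M i i).re + (M j j).re) / 2 := by
  set S := CFC.sqrt M
  have hS : Sᴴ * S = M := by
    rw [sqrt_isHermitian, CFC.sqrt_mul_sqrt_self M hM.nonneg]
  have hd : ∀ i, (M i i).re = ∑ k, ‖S k i‖ ^ 2 := fun i => by
    rw [← hS, Matrix.mul_apply, Complex.re_sum]
    refine Finset.sum_congr rfl fun k _ => ?_
    rw [conjTranspose_apply, RCLike.star_def, Complex.conj_mul', ← Complex.ofReal_pow,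
      Complex.ofReal_re]
  rw [hd, hd, ← Finset.sum_add_distrib, Finset.sum_div]
  nth_rw 1 [← hS]
  rw [Matrix.mul_apply]
  refine norm_sum_le_of_le _ fun k _ => ?_
  rw [norm_mul, conjTranspose_apply, norm_star]
  nlinarith [sq_nonneg (‖S k i‖ - ‖S k j‖)]

/-- The trace of `M` is the squared Hilbert–Schmidt norm of its square root. -/
theorem sq_norm_sqrt_apply_le {m : ℕ} {M : CMat m} (hM : M.PosSemidef) (i j : Fin m) :
    ‖CFC.sqrt M i j‖ ^ 2 ≤ ‖M.trace‖ := by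
  set S := CFC.sqrt M
  have hS : Sᴴ * S = M := by
    rw [sqrt_isHermitian, CFC.sqrt_mul_sqrt_self M hM.nonneg]
  have hd : M.trace.re = ∑ i, ∑ k, ‖S k i‖ ^ 2 := by
    rw [Matrix.trace, Complex.re_sum]
    refine Finset.sum_congr rfl fun i _ => ?_
    rw [Matrix.diag, ← hS, Matrix.mul_apply, Complex.re_sum]
    refine Finset.sum_congr rfl fun k _ => ?_
    rw [conjTranspose_apply, RCLike.star_def, Complex.conj_mul', ← Complex.ofReal_pow,
      Complex.ofReal_re]
  refine le_trans ?_ (Complex.re_le_norm _)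
  rw [hd]
  exact (Finset.single_le_sum (f := fun k => ‖S k j‖ ^ 2) (fun _ _ => by positivity)
    (Finset.mem_univ i)).trans (Finset.single_le_sum (f := fun j => ∑ k, ‖S k j‖ ^ 2)
      (fun _ _ => Finset.sum_nonneg fun _ _ => by positivity) (Finset.mem_univ j))

section
variable {m : ℕ} {Φ Ω Φx Φy : Torus → CMat m}

theorem IsBoundedCoercive.ae_posDef (h : IsBoundedCoercive Φ) :
    ∀ᵐ θ ∂torusMeasure, (Φ θ).PosDef := by
  obtain ⟨a, ha, h1⟩ := h.coercive
  filter_upwards [h1] with θ hθ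
  have h2 : ((a : ℂ) • (1 : CMat m)).PosDef :=
    Matrix.PosDef.one.smul (by exact_mod_cast ha)
  simpa using h2.posSemidef_add hθ

theorem IsBoundedCoercive.ae_norm_le (h : IsBoundedCoercive Φ) :
    ∃ b : ℝ, ∀ᵐ θ ∂torusMeasure, ∀ i j, ‖Φ θ i j‖ ≤ b := by
  obtain ⟨b, hb⟩ := h.bounded
  refine ⟨b, ?_⟩
  filter_upwards [hb, h.ae_posDef] with θ h1 h2 i j
  have hd : ∀ i, (Φ θ i i).re ≤ b := fun i => by
    have := (Complex.le_def.1 (h1.diag_nonneg (i := i))).1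
    simp at this
    linarith
  have := norm_apply_le_of_posSemidef h2.posSemidef i j
  have := hd i
  have := hd j
  linarith

theorem IsBoundedCoercive.aestronglyMeasurable (h : IsBoundedCoercive Φ) :
    AEStronglyMeasurable Φ torusMeasure :=
  aestronglyMeasurable_matrix_iff.2 h.measurable

theorem IsBoundedCoercive.torusIntegrable (h : IsBoundedCoercive Φ) : TorusIntegrable Φ := by
  obtain ⟨b, hb⟩ := h.ae_norm_le
  exact fun i j => Integrable.of_bound (h.measurable i j) b (hb.mono fun θ hθ => hθ i j)

theorem IsBoundedCoercive.torusIntegrable_mul (h : IsBoundedCoercive Φ) {Ψ : Torus → CMat m}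
    (hΨ : TorusIntegrable Ψ) : TorusIntegrable fun θ => Φ θ * Ψ θ := by
  obtain ⟨b, hb⟩ := h.ae_norm_le
  intro i j
  simp only [Matrix.mul_apply]
  exact integrable_finsetSum _ fun k _ =>
    (hΨ k j).bdd_mul (h.measurable i k) (hb.mono fun θ hθ => hθ i k)

theorem TorusIntegrable.trace {Ψ : Torus → CMat m} (hΨ : TorusIntegrable Ψ) :
    Integrable (fun θ => (Ψ θ).trace) torusMeasure :=
  integrable_finsetSum _ fun i _ => hΨ i i

theorem trace_torusIntegral {Ψ : Torus → CMat m} (hΨ : TorusIntegrable Ψ) :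
    (torusIntegral Ψ).trace = ∫ θ, (Ψ θ).trace ∂torusMeasure := by
  simp only [torusIntegral, Matrix.trace, Matrix.diag, Matrix.of_apply]
  rw [integral_finsetSum _ fun i _ => hΨ i i]

theorem ae_cross_posSemidef (hΩ : IsBoundedCoercive Ω) (hx : IsBoundedCoercive Φx)
    (Φy : Torus → CMat m) : ∀ᵐ θ ∂torusMeasure,
      (CFC.sqrt (Φy θ) * Ω θ * Φx θ * Ω θ * CFC.sqrt (Φy θ)).PosSemidef := by
  filter_upwards [hΩ.ae_posDef, hx.ae_posDef] with θ h1 h2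
  exact cross_posSemidef h1.1 h2.posSemidef

theorem aestronglyMeasurable_sqrt_density (hy : IsBoundedCoercive Φy) :
    AEStronglyMeasurable (fun θ => CFC.sqrt (Φy θ)) torusMeasure :=
  aestronglyMeasurable_sqrt hy.aestronglyMeasurable (hy.ae_posDef.mono fun _ h => h.posSemidef)

theorem aestronglyMeasurable_crossRoot (hΩ : IsBoundedCoercive Ω) (hx : IsBoundedCoercive Φx)
    (hy : IsBoundedCoercive Φy) :
    AEStronglyMeasurable (fun θ => crossRoot (Ω θ) (Φx θ) (Φy θ)) torusMeasure := by
  have hB := aestronglyMeasurable_sqrt_density hy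
  have hΩm := hΩ.aestronglyMeasurable
  exact aestronglyMeasurable_sqrt ((((hB.mul hΩm).mul hx.aestronglyMeasurable).mul hΩm).mul hB)
    (ae_cross_posSemidef hΩ hx Φy)

/-- The squared entries of the root are bounded by `|tr (Ω Φx Ω Φy)|`, which is integrable, and `u ≤
1 + u²`. -/
theorem torusIntegrable_crossRoot (hΩ : IsBoundedCoercive Ω) (hx : IsBoundedCoercive Φx)
    (hy : IsBoundedCoercive Φy) :
    TorusIntegrable fun θ => crossRoot (Ω θ) (Φx θ) (Φy θ) := by
  intro i j
  have h1 := (hΩ.torusIntegrable_mul (hx.torusIntegrable_mul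
    (hΩ.torusIntegrable_mul hy.torusIntegrable))).trace
  refine ((integrable_const (1 : ℝ)).add h1.norm).mono
    (aestronglyMeasurable_matrix_iff.1 (aestronglyMeasurable_crossRoot hΩ hx hy) i j) ?_
  filter_upwards [ae_cross_posSemidef hΩ hx Φy, hy.ae_posDef] with θ h2 h3
  have h4 := sq_norm_sqrt_apply_le h2 i j
  have h5 : (CFC.sqrt (Φy θ) * Ω θ * Φx θ * Ω θ * CFC.sqrt (Φy θ)).trace =
      (Ω θ * (Φx θ * (Ω θ * Φy θ))).trace := by
    rw [Matrix.mul_assoc, Matrix.mul_assoc, Matrix.mul_assoc, Matrix.trace_mul_comm]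
    simp only [Matrix.mul_assoc]
    rw [CFC.sqrt_mul_sqrt_self _ h3.posSemidef.nonneg]
  rw [h5] at h4
  change ‖crossRoot _ _ _ i j‖ ≤ ‖1 + ‖_‖‖
  rw [Real.norm_of_nonneg (by positivity)]
  have h6 : ‖crossRoot (Ω θ) (Φx θ) (Φy θ) i j‖ ^ 2 ≤ _ := h4
  nlinarith [sq_nonneg (‖crossRoot (Ω θ) (Φx θ) (Φy θ) i j‖ - 1)]

theorem torusIntegrable_hellingerIntegrand (hΩ : IsBoundedCoercive Ω)
    (hx : IsBoundedCoercive Φx) (hy : IsBoundedCoercive Φy) :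
    TorusIntegrable (hellingerIntegrand Ω Φx Φy) := fun i j =>
  (((hΩ.torusIntegrable_mul hx.torusIntegrable i j).add
    (hΩ.torusIntegrable_mul hy.torusIntegrable i j)).sub
      ((torusIntegrable_crossRoot hΩ hx hy i j).const_mul 2))

theorem hellingerIntegrand_eq (θ : Torus) : hellingerIntegrand Ω Φx Φy θ =
    Ω θ * Φx θ + Ω θ * Φy θ - (2 : ℂ) • crossRoot (Ω θ) (Φx θ) (Φy θ) := rfl

theorem trace_mul_im_eq_zero {M N : CMat m} (hM : M.IsHermitian) (hN : N.IsHermitian) :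
    (M * N).trace.im = 0 := by
  have h : star (M * N).trace = (M * N).trace := by
    rw [← Matrix.trace_conjTranspose, conjTranspose_mul, hM.eq, hN.eq, Matrix.trace_mul_comm]
  exact Complex.conj_eq_iff_im.1 h

/-- The integrand itself need not be Hermitian, but its trace is real, because the product of two
Hermitian matrices has real trace. -/
theorem trace_torusIntegral_hellingerIntegrand (hΩ : IsBoundedCoercive Ω)
    (hx : IsBoundedCoercive Φx) (hy : IsBoundedCoercive Φy) :
    (torusIntegral (hellingerIntegrand Ω Φx Φy)).trace =
      ((∫ θ, (hellingerIntegrand Ω Φx Φy θ).trace.re ∂torusMeasure : ℝ) : ℂ) := by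
  rw [trace_torusIntegral (torusIntegrable_hellingerIntegrand hΩ hx hy), ← integral_complex_ofReal]
  refine integral_congr_ae ?_
  filter_upwards [hΩ.ae_posDef, hx.ae_posDef, hy.ae_posDef] with θ h1 h2 h3
  refine Complex.ext rfl ?_
  have hS := (crossRoot_posDef h1 h2 h3).posSemidef
  have h4 : (crossRoot (Ω θ) (Φx θ) (Φy θ)).trace.im = 0 := by
    simpa using trace_mul_im_eq_zero (isHermitian_one) hS.1
  rw [hellingerIntegrand_eq, Complex.ofReal_im]
  simp [Matrix.trace_sub, Matrix.trace_add, trace_mul_im_eq_zero h1.1 h2.1,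
    trace_mul_im_eq_zero h1.1 h3.1, h4]

end

end

/-! ### Lower bound for the cost of an arbitrary coupling -/

section
open Matrix

/-- Bessel inequality: the correlations of a square integrable variable with a stationary process
whose spectral density is bounded are square summable. -/
theorem summable_sq_correlation {Ω : Type*} [MeasurableSpace Ω] {P : Measure Ω}
    {x : ℤ → Ω → ℝ} {y : Ω → ℝ} (hx : ∀ t, MemLp (x t) 2 P) (hy : MemLp y 2 P)
    {φ : Torus → ℂ} (hφ : Integrable φ torusMeasure) {b : ℝ}
    (hb : ∀ᵐ θ ∂torusMeasure, ‖φ θ‖ ≤ b)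
    (hcov : ∀ s t, ((∫ ω, x s ω * x t ω ∂P : ℝ) : ℂ) =
      ∫ θ, fourier (s - t) θ * φ θ ∂torusMeasure) :
    Summable fun k => (∫ ω, x k ω * y ω ∂P) ^ 2 := by
  set c : ℤ → ℝ := fun k => ∫ ω, x k ω * y ω ∂P with hc
  set Y : ℝ := ∫ ω, y ω ^ 2 ∂P
  -- The maximum with `1` makes the bound strictly positive, so that `β` can be cancelled at the
  -- end.
  set β : ℝ := max b 1
  have hβ : 0 < β := lt_max_of_lt_right one_pos
  refine summable_of_sum_le (c := β * Y) (fun k => sq_nonneg _) fun s => ?_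
  set T : ℝ := ∑ k ∈ s, c k ^ 2 with hT
  set Z : Ω → ℝ := fun ω => ∑ k ∈ s, c k * x k ω with hZ
  have hZ2 : MemLp Z 2 P := memLp_finsetSum s fun k _ => (hx k).const_mul (c k)
  have hZy : ∫ ω, Z ω * y ω ∂P = T := by
    have hi : ∀ k, Integrable (fun ω => c k * (x k ω * y ω)) P := fun k =>
      ((hx k).integrable_mul hy).const_mul (c k)
    simp only [hZ, Finset.sum_mul, mul_assoc]
    rw [integral_finsetSum _ fun k _ => hi k]
    refine Finset.sum_congr rfl fun k _ => ?_
    rw [integral_const_mul, sq]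
  -- the second moment of `Z` in the spectral domain
  set q : Torus → ℂ := fun θ => ∑ k ∈ s, (c k : ℂ) * fourier k θ with hq
  have hqc : Continuous q := by fun_prop
  have hqq : ∀ θ, ((‖q θ‖ ^ 2 : ℝ) : ℂ) =
      ∑ k ∈ s, ∑ l ∈ s, ((c k * c l : ℝ) : ℂ) * fourier (k - l) θ := fun θ => by
    rw [Complex.ofReal_pow, ← Complex.mul_conj', hq, map_sum, Finset.sum_mul_sum]
    refine Finset.sum_congr rfl fun k _ => Finset.sum_congr rfl fun l _ => ?_
    rw [sub_eq_add_neg, fourier_add, ← star_fourier, map_mul, Complex.conj_ofReal,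
      Complex.ofReal_mul, RCLike.star_def]
    ring
  have hint : ∀ ψ : Torus → ℂ, Integrable ψ torusMeasure →
      ∫ θ, ((‖q θ‖ ^ 2 : ℝ) : ℂ) * ψ θ ∂torusMeasure = ∑ k ∈ s, ∑ l ∈ s, ((c k * c l : ℝ) : ℂ) *
        ∫ θ, fourier (k - l) θ * ψ θ ∂torusMeasure := fun ψ hψ => by
    simp_rw [hqq, Finset.sum_mul, mul_assoc]
    have hi : ∀ k l, Integrable (fun θ => ((c k * c l : ℝ) : ℂ) * (fourier (k - l) θ * ψ θ))
      torusMeasure := fun k l => (integrable_fourier_mul hψ _).const_mul _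
    rw [integral_finsetSum _ fun k _ => integrable_finsetSum _ fun l _ => hi k l]
    refine Finset.sum_congr rfl fun k _ => ?_
    rw [integral_finsetSum _ fun l _ => hi k l]
    exact Finset.sum_congr rfl fun l _ => integral_const_mul _ _
  have hqφ : ((∫ ω, Z ω ^ 2 ∂P : ℝ) : ℂ) =
      ∫ θ, ((‖q θ‖ ^ 2 : ℝ) : ℂ) * φ θ ∂torusMeasure := by
    rw [hint φ hφ]
    simp only [hZ, sq, Finset.sum_mul_sum]
    have hi : ∀ k l, Integrable (fun ω => c k * x k ω * (c l * x l ω)) P := fun k l =>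
      ((hx k).const_mul _).integrable_mul ((hx l).const_mul _)
    rw [integral_finsetSum _ fun k _ => integrable_finsetSum _ fun l _ => hi k l,
      Complex.ofReal_sum]
    refine Finset.sum_congr rfl fun k _ => ?_
    rw [integral_finsetSum _ fun l _ => hi k l, Complex.ofReal_sum]
    refine Finset.sum_congr rfl fun l _ => ?_
    rw [← hcov, ← Complex.ofReal_mul, ← integral_const_mul]
    congr with ω
    ring
  have hq2 : ∫ θ, ‖q θ‖ ^ 2 ∂torusMeasure = T := by
    have h1 := hint (fun _ => 1) (integrable_const 1)
    simp only [mul_one] at h1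
    rw [integral_complex_ofReal] at h1
    have h2 : ∀ n : ℤ, ∫ θ, (fourier n θ : ℂ) ∂torusMeasure = if n = 0 then 1 else 0 := fun n => by
      have := fourierCoeff_fourier (T := 2 * Real.pi) n
      have h3 := congrFun this 0
      rw [fourierCoeff] at h3
      simpa [Pi.single_apply, eq_comm] using h3
    simp only [h2, sub_eq_zero, mul_ite, mul_one, mul_zero, Finset.sum_ite_eq] at h1
    rw [Finset.sum_congr rfl fun k hk => if_pos hk] at h1
    rw [hT, Finset.sum_congr rfl fun k _ => sq (c k)]
    exact_mod_cast h1
  have hqint : Integrable (fun θ => ‖q θ‖ ^ 2) torusMeasure :=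
    (hqc.norm.pow 2).integrable_of_hasCompactSupport (HasCompactSupport.of_compactSpace _)
  have hZT : ∫ ω, Z ω ^ 2 ∂P ≤ β * T := by
    have h1 : ‖∫ θ, ((‖q θ‖ ^ 2 : ℝ) : ℂ) * φ θ ∂torusMeasure‖ ≤
        ∫ θ, β * ‖q θ‖ ^ 2 ∂torusMeasure := by
      refine norm_integral_le_of_norm_le (hqint.const_mul _) ?_
      filter_upwards [hb] with θ hθ
      rw [norm_mul, Complex.norm_real, norm_pow, norm_norm, mul_comm]
      exact mul_le_mul_of_nonneg_right (hθ.trans (le_max_left _ _)) (by positivity)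
    rw [← hqφ, integral_const_mul, hq2, Complex.norm_real] at h1
    exact (le_abs_self _).trans h1
  -- Here `E[Z y] = T` and `E[Z²] ≤ β T`, so expanding the square gives `0 ≤ β T - 2 β T + β² Y`,
  -- that is `T ≤ β Y`, uniformly in the finite set `s`.
  have hquad : 0 ≤ ∫ ω, (Z ω - β * y ω) ^ 2 ∂P := integral_nonneg fun ω => sq_nonneg _
  have hexp : ∫ ω, (Z ω - β * y ω) ^ 2 ∂P = ∫ ω, Z ω ^ 2 ∂P - 2 * β * T + β ^ 2 * Y := by
    have i1 : Integrable (fun ω => Z ω ^ 2) P := hZ2.integrable_sq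
    have i2 : Integrable (fun ω => 2 * β * (Z ω * y ω)) P := (hZ2.integrable_mul hy).const_mul _
    have i3 : Integrable (fun ω => β ^ 2 * y ω ^ 2) P := hy.integrable_sq.const_mul _
    have i4 : Integrable (fun ω => Z ω ^ 2 - 2 * β * (Z ω * y ω)) P := i1.sub i2
    rw [← hZy, ← integral_const_mul, ← integral_const_mul, ← integral_sub i1 i2,
      ← integral_add i4 i3]
    congr with ω
    ring
  rw [hexp] at hquad
  have h4 : β * T ≤ β * (β * Y) := by nlinarith
  exact le_of_mul_le_mul_left h4 hβ

theorem integrable_star {α : Type*} [MeasurableSpace α] {μ : Measure α} {f : α → ℂ}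
    (hf : Integrable f μ) : Integrable (fun a => star (f a)) μ :=
  ContinuousLinearMap.integrable_comp (Complex.conjCLE : ℂ →L[ℝ] ℂ) hf

theorem integral_sub_sub_add {α E : Type*} [MeasurableSpace α] {μ : Measure α}
    [NormedAddCommGroup E] [NormedSpace ℝ E] {f₁ f₂ f₃ f₄ : α → E} (h₁ : Integrable f₁ μ)
    (h₂ : Integrable f₂ μ) (h₃ : Integrable f₃ μ) (h₄ : Integrable f₄ μ) :
    ∫ a, (f₁ a - f₂ a - f₃ a + f₄ a) ∂μ =
      ∫ a, f₁ a ∂μ - ∫ a, f₂ a ∂μ - ∫ a, f₃ a ∂μ + ∫ a, f₄ a ∂μ := by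
  have h₁₂ : Integrable (fun a => f₁ a - f₂ a) μ := h₁.sub h₂
  have h₁₂₃ : Integrable (fun a => f₁ a - f₂ a - f₃ a) μ := h₁₂.sub h₃
  rw [integral_add h₁₂₃ h₄, integral_sub h₁₂ h₃, integral_sub h₁ h₂]

section coupling
variable {Ω₁ Ω₂ : Type*} [MeasurableSpace Ω₁] [MeasurableSpace Ω₂] {P : Measure Ω₁}
  {Q : Measure Ω₂} {m : ℕ} {X : ℤ → Ω₁ → Vec m} {Y : ℤ → Ω₂ → Vec m}
  {π : Measure (ℤ → Vec m × Vec m)}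

theorem IsGaussianCoupling.memLp (h : IsGaussianCoupling X P Y Q π) (t : ℤ) :
    MemLp (fun w : ℤ → Vec m × Vec m => w t) 2 π :=
  (h.gaussian.hasGaussianLaw_eval t).memLp_two

theorem IsGaussianCoupling.memLp_fst (h : IsGaussianCoupling X P Y Q π) (t : ℤ) :
    MemLp (fun w : ℤ → Vec m × Vec m => (w t).1) 2 π :=
  (ContinuousLinearMap.fst ℝ (Vec m) (Vec m)).comp_memLp' (h.memLp t)

theorem IsGaussianCoupling.memLp_snd (h : IsGaussianCoupling X P Y Q π) (t : ℤ) :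
    MemLp (fun w : ℤ → Vec m × Vec m => (w t).2) 2 π :=
  (ContinuousLinearMap.snd ℝ (Vec m) (Vec m)).comp_memLp' (h.memLp t)

theorem IsSpectralDensity.covariance_sub {Φ : Torus → CMat m} (h : IsSpectralDensity X P Φ)
    (s t : ℤ) (i j : Fin m) : ((∫ ω, X s ω i * X t ω j ∂P : ℝ) : ℂ) =
      ∫ θ, fourier (s - t) θ * Φ θ i j ∂torusMeasure := by
  rw [← h.covariance t (s - t), add_sub_cancel]

theorem IsGaussianCoupling.integral_fst (h : IsGaussianCoupling X P Y Q π)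
    (hX : IsGaussianProcess X P) (s t : ℤ) (i j : Fin m) :
    ∫ w, (w s).1 i * (w t).1 j ∂π = ∫ ω, X s ω i * X t ω j ∂P := by
  have h1 := integral_map (μ := π) (φ := fun w => ((w s).1, (w t).1))
    (f := fun p : Vec m × Vec m => p.1 i * p.2 j) (by fun_prop) (by fun_prop)
  have h2 := integral_map (μ := P) (φ := fun ω => (X s ω, X t ω))
    (f := fun p : Vec m × Vec m => p.1 i * p.2 j)
    ((hX.aemeasurable s).prodMk (hX.aemeasurable t)) (by fun_prop)
  rw [← h1, h.marginal_fst, h2]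

theorem IsGaussianCoupling.integral_snd (h : IsGaussianCoupling X P Y Q π)
    (hY : IsGaussianProcess Y Q) (s t : ℤ) (i j : Fin m) :
    ∫ w, (w s).2 i * (w t).2 j ∂π = ∫ ω, Y s ω i * Y t ω j ∂Q := by
  have h1 := integral_map (μ := π) (φ := fun w => ((w s).2, (w t).2))
    (f := fun p : Vec m × Vec m => p.1 i * p.2 j) (by fun_prop) (by fun_prop)
  have h2 := integral_map (μ := Q) (φ := fun ω => (Y s ω, Y t ω))
    (f := fun p : Vec m × Vec m => p.1 i * p.2 j)
    ((hY.aemeasurable s).prodMk (hY.aemeasurable t)) (by fun_prop)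
  rw [← h1, h.marginal_snd, h2]

/-- The marginal conditions say nothing about cross correlations; joint stationarity, applied to the
shift by `t`, reduces them to functions of the lag. -/
theorem IsGaussianCoupling.integral_cross (h : IsGaussianCoupling X P Y Q π)
    (s t : ℤ) (i j : Fin m) :
    ∫ w, (w s).1 i * (w t).2 j ∂π = ∫ w, (w (s - t)).1 i * (w 0).2 j ∂π := by
  have h1 := integral_map (μ := π) (φ := fun (w : ℤ → Vec m × Vec m) r => w (r + t))
    (f := fun w : ℤ → Vec m × Vec m => (w (s - t)).1 i * (w 0).2 j)
    (measurable_pi_lambda _ fun r => measurable_pi_apply (r + t)).aemeasurable (by fun_prop)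
  have h2 : π.map (fun (w : ℤ → Vec m × Vec m) r => w (r + t)) = π := by
    rw [h.stationary t, Measure.map_id']
  rw [h2] at h1
  simp only [sub_add_cancel, zero_add] at h1
  exact h1.symm

/-- The spectral density of the pair of processes of a coupling. -/
theorem IsGaussianCoupling.exists_crossDensity (h : IsGaussianCoupling X P Y Q π)
    (hX : IsGaussianProcess X P) (hY : IsGaussianProcess Y Q) {Φx Φy : Torus → CMat m}
    (hΦx : IsSpectralDensity X P Φx) (hΦy : IsSpectralDensity Y Q Φy)
    (hΦxS : IsBoundedCoercive Φx) (hΦyS : IsBoundedCoercive Φy) :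
    ∃ Ψ : Torus → CMat m, TorusIntegrable Ψ ∧
      (∀ s t i j, ((∫ w, (w s).1 i * (w t).2 j ∂π : ℝ) : ℂ) =
        ∫ θ, fourier (s - t) θ * Ψ θ i j ∂torusMeasure) ∧
      (∀ s t i j, ((∫ w, (w s).2 i * (w t).1 j ∂π : ℝ) : ℂ) =
        ∫ θ, fourier (s - t) θ * (Ψ θ)ᴴ i j ∂torusMeasure) ∧
      ∀ᵐ θ ∂torusMeasure, (fromBlocks (Φx θ) (Ψ θ) (Ψ θ)ᴴ (Φy θ)).PosSemidef := by
  have := h.gaussian.isProbabilityMeasure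
  obtain ⟨b, hb⟩ := hΦxS.ae_norm_le
  have h1 : ∀ i j, ∃ g : Torus → ℂ, MemLp g 2 torusMeasure ∧ ∀ k,
      ∫ θ, fourier k θ * g θ ∂torusMeasure = ((∫ w, (w k).1 i * (w 0).2 j ∂π : ℝ) : ℂ) := by
    intro i j
    have hs := summable_sq_correlation (P := π) (x := fun t w => (w t).1 i)
      (y := fun w => (w 0).2 j) (φ := fun θ => Φx θ i i) (b := b)
      (fun t => MemLp.euclidean_apply (h.memLp_fst t) i) (MemLp.euclidean_apply (h.memLp_snd 0) j)
      (hΦx.integrable i i) (hb.mono fun θ hθ => hθ i i)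
      fun s t => by rw [h.integral_fst hX, hΦx.covariance_sub]
    refine exists_memLp_integral_fourier_eq (hs.congr fun k => ?_)
    rw [Complex.norm_real, Real.norm_eq_abs, sq_abs]
  choose g hg2 hg using h1
  have hgi : ∀ i j, Integrable (g i j) torusMeasure := fun i j =>
    (hg2 i j).integrable (by norm_num)
  have e1 : ∀ s t i j, ((∫ w, (w s).1 i * (w t).2 j ∂π : ℝ) : ℂ) =
      ∫ θ, fourier (s - t) θ * g i j θ ∂torusMeasure := fun s t i j => by
    rw [h.integral_cross, hg]
  have e2 : ∀ s t i j, ((∫ w, (w s).2 i * (w t).1 j ∂π : ℝ) : ℂ) =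
      ∫ θ, fourier (s - t) θ * star (g j i θ) ∂torusMeasure := fun s t i j => by
    have h2 := congrArg (starRingEnd ℂ) (e1 t s j i)
    rw [Complex.conj_ofReal, ← integral_conj] at h2
    simp_rw [mul_comm ((_ : EuclideanSpace ℝ (Fin m)) i)]
    rw [h2]
    refine integral_congr_ae (Filter.Eventually.of_forall fun θ => ?_)
    change (starRingEnd ℂ) _ = _
    rw [map_mul, ← RCLike.star_def, star_fourier, neg_sub]
  refine ⟨fun θ => Matrix.of fun i j => g i j θ, hgi, e1, e2, ?_⟩
  refine ae_posSemidef_of_covariance (P := π) (A := Fin m ⊕ Fin m)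
    (W := fun t => Sum.elim (fun i w => (w t).1 i) fun i w => (w t).2 i) ?_ ?_ ?_ ?_
  · rintro t (i | i)
    · exact MemLp.euclidean_apply (h.memLp_fst t) i
    · exact MemLp.euclidean_apply (h.memLp_snd t) i
  · rintro (i | i) (j | j)
    · exact hΦx.integrable i j
    · exact hgi i j
    · exact integrable_star (hgi j i)
    · exact hΦy.integrable i j
  · filter_upwards [hΦxS.ae_posDef, hΦyS.ae_posDef] with θ h1 h2
    exact h1.1.fromBlocks rfl h2.1
  · rintro s t (i | i) (j | j)
    · exact (congrArg _ (h.integral_fst hX s t i j)).trans (hΦx.covariance_sub s t i j)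
    · exact e1 s t i j
    · exact e2 s t i j
    · exact (congrArg _ (h.integral_snd hY s t i j)).trans (hΦy.covariance_sub s t i j)

/-- The discrepancy has density `Φx - Ψ - Ψᴴ + Φy`, so its filtered power is the integral of `tr Ω
(Φx - Ψ - Ψᴴ + Φy)`, to which the matrix inequality applies at almost every angle. -/
theorem IsGaussianCoupling.cost_ge (h : IsGaussianCoupling X P Y Q π)
    (hX : IsGaussianProcess X P) (hY : IsGaussianProcess Y Q) {Φx Φy : Torus → CMat m}
    (hΦx : IsSpectralDensity X P Φx) (hΦy : IsSpectralDensity Y Q Φy)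
    {f : ℤ → Matrix (Fin m) (Fin m) ℝ} (hf : IsBIBO f)
    (hΩS : IsBoundedCoercive (weight f))
    (hΦxS : IsBoundedCoercive Φx) (hΦyS : IsBoundedCoercive Φy) (t : ℤ) :
    (∀ᵐ w ∂π, ConvConverges f (discrepancy w) t) ∧
    Integrable (fun w => ‖conv f (discrepancy w) t‖ ^ 2) π ∧
    ∫ θ, (hellingerIntegrand (weight f) Φx Φy θ).trace.re ∂torusMeasure ≤ cost f t π := by
  have := h.gaussian.isProbabilityMeasure
  obtain ⟨Ψ, hΨ, e1, e2, hpsd⟩ := h.exists_crossDensity hX hY hΦx hΦy hΦxS hΦyS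
  have hΨ' : TorusIntegrable fun θ => (Ψ θ)ᴴ := fun i j => integrable_star (hΨ j i)
  have hΦz : TorusIntegrable fun θ => Φx θ - Ψ θ - (Ψ θ)ᴴ + Φy θ := fun i j =>
    (((hΦx.integrable i j).sub (hΨ i j)).sub (hΨ' i j)).add (hΦy.integrable i j)
  have hcov : ∀ t k i j, ∫ w, discrepancy w (t + k) i * discrepancy w t j ∂π =
      (∫ θ, fourier k θ * (Φx θ - Ψ θ - (Ψ θ)ᴴ + Φy θ) i j ∂torusMeasure).re := by
    intro t k i j
    have m1 := fun s i => MemLp.euclidean_apply (h.memLp_fst s) i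
    have m2 := fun s i => MemLp.euclidean_apply (h.memLp_snd s) i
    have a1 : Integrable (fun w : ℤ → Vec m × Vec m => (w (t + k)).1 i * (w t).1 j) π :=
      (m1 (t + k) i).integrable_mul (m1 t j)
    have a2 : Integrable (fun w : ℤ → Vec m × Vec m => (w (t + k)).1 i * (w t).2 j) π :=
      (m1 (t + k) i).integrable_mul (m2 t j)
    have a3 : Integrable (fun w : ℤ → Vec m × Vec m => (w (t + k)).2 i * (w t).1 j) π :=
      (m2 (t + k) i).integrable_mul (m1 t j)
    have a4 : Integrable (fun w : ℤ → Vec m × Vec m => (w (t + k)).2 i * (w t).2 j) π :=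
      (m2 (t + k) i).integrable_mul (m2 t j)
    have l : ∫ w, discrepancy w (t + k) i * discrepancy w t j ∂π =
        ∫ w, (w (t + k)).1 i * (w t).1 j ∂π - ∫ w, (w (t + k)).1 i * (w t).2 j ∂π -
        ∫ w, (w (t + k)).2 i * (w t).1 j ∂π + ∫ w, (w (t + k)).2 i * (w t).2 j ∂π := by
      rw [← integral_sub_sub_add a1 a2 a3 a4]
      congr with w
      simp only [discrepancy, PiLp.sub_apply]
      ring
    have r : ∫ θ, fourier k θ * (Φx θ - Ψ θ - (Ψ θ)ᴴ + Φy θ) i j ∂torusMeasure =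
        ∫ θ, fourier k θ * Φx θ i j ∂torusMeasure - ∫ θ, fourier k θ * Ψ θ i j ∂torusMeasure -
        ∫ θ, fourier k θ * (Ψ θ)ᴴ i j ∂torusMeasure +
        ∫ θ, fourier k θ * Φy θ i j ∂torusMeasure := by
      rw [← integral_sub_sub_add (integrable_fourier_mul (hΦx.integrable i j) k)
        (integrable_fourier_mul (hΨ i j) k) (integrable_fourier_mul (hΨ' i j) k)
        (integrable_fourier_mul (hΦy.integrable i j) k)]
      congr with θ
      simp only [Matrix.add_apply, Matrix.sub_apply]
      ring
    have q1 := (congrArg Complex.ofReal (h.integral_fst hX (t + k) t i j)).trans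
      (hΦx.covariance t k i j)
    have q4 := (congrArg Complex.ofReal (h.integral_snd hY (t + k) t i j)).trans
      (hΦy.covariance t k i j)
    have q2 := e1 (t + k) t i j
    have q3 := e2 (t + k) t i j
    rw [add_sub_cancel_left] at q2 q3
    rw [r, ← q1, ← q2, ← q3, ← q4, l]
    norm_cast
  obtain ⟨c1, c2, c3⟩ := conv_second_moment (P := π) (z := fun t w => discrepancy w t)
    (Φ := fun θ => Φx θ - Ψ θ - (Ψ θ)ᴴ + Φy θ)
    (fun t => (h.memLp_fst t).sub (h.memLp_snd t)) hΦz hcov hf.summable_entrySum t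
  refine ⟨c1, c2, ?_⟩
  have hi := (hΩS.torusIntegrable_mul hΦz).trace
  rw [cost, c3, ← RCLike.re_eq_complex_re, ← integral_re hi]
  refine integral_mono_ae (torusIntegrable_hellingerIntegrand hΩS hΦxS hΦyS).trace.re hi.re ?_
  filter_upwards [hΩS.ae_posDef, hΦxS.ae_posDef, hΦyS.ae_posDef, hpsd] with θ h1 h2 h3 h4
  exact re_trace_le_of_fromBlocks_posSemidef h1 h2 h3 h4

end coupling

end

/-! ### Construction of an optimal coupling -/

section
open Matrix

/-- A real Gaussian process whose covariances are the real parts of the Fourier coefficients of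
`G Gᴴ`. -/
theorem exists_gaussianProcess_of_factor {A : Type*} [Countable A] {m : ℕ}
    {G : Torus → Matrix A (Fin m) ℂ} (hG : ∀ a l, MemLp (fun θ => G θ a l) 2 torusMeasure) :
    ∃ W : ℤ × A → (ℕ → ℝ) → ℝ, (∀ p, Measurable (W p)) ∧ IsGaussianProcess W whiteNoise ∧
      (∀ p, ∫ x, W p x ∂whiteNoise = 0) ∧
      ∀ s t a b, ∫ x, W (s, a) x * W (t, b) x ∂whiteNoise =
        (∫ θ, fourier (s - t) θ * (G θ * (G θ)ᴴ) a b ∂torusMeasure).re := by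
  -- The vector attached to time `s` and index `a` is `e^{isϑ}` times row `a` of `G`. Its `L²` space
  -- is used as a real Hilbert space, whose inner product is the real part of the complex one.
  have hmem : ∀ p : ℤ × A, MemLp (fun θ => (WithLp.toLp 2 fun l => fourier p.1 θ * G θ p.2 l :
      EuclideanSpace ℂ (Fin m))) 2 torusMeasure := fun p => by
    refine MemLp.of_eval_piLp fun l => ?_
    refine (hG p.2 l).of_le ((fourier p.1).continuous.aestronglyMeasurable.mul (hG p.2 l).1)
      (Filter.Eventually.of_forall fun θ => ?_)
    change ‖fourier p.1 θ * G θ p.2 l‖ ≤ _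
    rw [norm_mul, norm_fourier_apply, one_mul]
  obtain ⟨W, h1, h2, h3, h4⟩ := exists_gaussianProcess fun p => (hmem p).toLp
  refine ⟨W, h1, h2, h3, fun s t a b => ?_⟩
  rw [h4, L2.inner_def]
  have hi : ∀ l, Integrable (fun θ => G θ a l * star (G θ b l)) torusMeasure := fun l =>
    (hG a l).integrable_mul (hG b l).star
  have hI : Integrable (fun θ => (G θ * (G θ)ᴴ) a b) torusMeasure := by
    simp only [Matrix.mul_apply, conjTranspose_apply]
    exact integrable_finsetSum _ fun l _ => hi l
  rw [← RCLike.re_eq_complex_re, ← integral_re (integrable_fourier_mul hI _)]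
  refine integral_congr_ae ?_
  filter_upwards [(hmem (s, a)).coeFn_toLp, (hmem (t, b)).coeFn_toLp] with θ e1 e2
  rw [e1, e2, PiLp.inner_apply, Matrix.mul_apply, Finset.mul_sum, map_sum]
  refine Finset.sum_congr rfl fun l _ => ?_
  rw [Complex.inner, conjTranspose_apply, RCLike.re_eq_complex_re, sub_eq_add_neg, fourier_add,
    ← star_fourier, ← Complex.conj_re, map_mul, Complex.conj_conj, map_mul, RCLike.star_def]
  congr 1
  simp only
  ring

section process
variable {Ω : Type*} [MeasurableSpace Ω] {P : Measure Ω} {m : ℕ}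

/-- The pair of vector valued processes with the given coordinates. -/
def pairProcess (W : ℤ × (Fin m ⊕ Fin m) → ℝ) (t : ℤ) : Vec m × Vec m :=
  (WithLp.toLp 2 fun i => W (t, .inl i), WithLp.toLp 2 fun i => W (t, .inr i))

theorem measurable_pairProcess :
    Measurable fun (W : ℤ × (Fin m ⊕ Fin m) → ℝ) t => pairProcess W t := by
  refine measurable_pi_lambda _ fun t => ?_
  unfold pairProcess
  fun_prop

theorem isGaussianProcess_pairProcess {W : ℤ × (Fin m ⊕ Fin m) → Ω → ℝ}
    (hW : IsGaussianProcess W P) :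
    IsGaussianProcess (fun t ω => pairProcess (fun p => W p ω) t) P := by
  refine hW.of_isGaussianProcess fun t => ⟨Finset.univ.image fun a => (t, a), ?_⟩
  have hm : ∀ a, (t, a) ∈ Finset.univ.image fun a : Fin m ⊕ Fin m => (t, a) := fun a =>
    Finset.mem_image_of_mem _ (Finset.mem_univ a)
  refine ⟨LinearMap.toContinuousLinearMap
    { toFun := fun u => (WithLp.toLp 2 fun i => u ⟨_, hm (.inl i)⟩,
        WithLp.toLp 2 fun i => u ⟨_, hm (.inr i)⟩)
      map_add' := fun u v => rfl
      map_smul' := fun c u => rfl }, fun ω => rfl⟩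

theorem IsZeroMeanStationaryGaussian.isGaussianProcess_coord {X : ℤ → Ω → Vec m}
    (hX : IsZeroMeanStationaryGaussian X P) :
    IsGaussianProcess (fun (p : ℤ × Fin m) ω => X p.1 ω p.2) P :=
  hX.gaussian.of_isGaussianProcess fun p => ⟨{p.1},
    (EuclideanSpace.proj (𝕜 := ℝ) p.2 : Vec m →L[ℝ] ℝ) ∘L
      ContinuousLinearMap.proj ⟨p.1, Finset.mem_singleton_self _⟩, fun _ => rfl⟩

theorem IsZeroMeanStationaryGaussian.integral_coord {X : ℤ → Ω → Vec m}
    (hX : IsZeroMeanStationaryGaussian X P) (p : ℤ × Fin m) : ∫ ω, X p.1 ω p.2 ∂P = 0 := by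
  have h1 : Integrable (X p.1) P := (hX.gaussian.hasGaussianLaw_eval p.1).integrable
  have h2 := (EuclideanSpace.proj (𝕜 := ℝ) p.2 : Vec m →L[ℝ] ℝ).integral_comp_comm h1
  rw [hX.mean_zero, map_zero] at h2
  exact h2

/-- A Gaussian process with the covariances of `X` has the two-time marginals of `X`. -/
theorem IsZeroMeanStationaryGaussian.map_pair_eq {Ω' : Type*} [MeasurableSpace Ω']
    {P' : Measure Ω'} {X : ℤ → Ω → Vec m} (hX : IsZeroMeanStationaryGaussian X P)
    {Φ : Torus → CMat m} (hΦ : IsSpectralDensity X P Φ) {U : ℤ × Fin m → Ω' → ℝ}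
    (hU : IsGaussianProcess U P') (hUm : ∀ p, Measurable (U p)) (hU0 : ∀ p, ∫ ω, U p ω ∂P' = 0)
    (hUc : ∀ s t i j, ∫ ω, U (s, i) ω * U (t, j) ω ∂P' =
      (∫ θ, fourier (s - t) θ * Φ θ i j ∂torusMeasure).re) (t s : ℤ) :
    P'.map (fun ω => ((WithLp.toLp 2 fun i => U (t, i) ω : Vec m),
      (WithLp.toLp 2 fun i => U (s, i) ω : Vec m))) = P.map (fun ω => (X t ω, X s ω)) := by
  have hXm : AEMeasurable (fun ω (p : ℤ × Fin m) => X p.1 ω p.2) P :=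
    aemeasurable_pi_iff.2 fun p => hX.isGaussianProcess_coord.aemeasurable p
  have hUm' : Measurable (fun ω p => U p ω) := measurable_pi_lambda _ hUm
  have h1 := map_gaussianProcess_eq hU hX.isGaussianProcess_coord hUm'.aemeasurable hXm hU0
    hX.integral_coord fun p q => by
      have := hΦ.covariance_sub p.1 q.1 p.2 q.2
      rw [hUc, ← this, Complex.ofReal_re]
  have hφ : Measurable fun u : ℤ × Fin m → ℝ => ((WithLp.toLp 2 fun i => u (t, i) : Vec m),
      (WithLp.toLp 2 fun i => u (s, i) : Vec m)) := by fun_prop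
  have h2 := congrArg (Measure.map fun u : ℤ × Fin m → ℝ =>
    ((WithLp.toLp 2 fun i => u (t, i) : Vec m), (WithLp.toLp 2 fun i => u (s, i) : Vec m))) h1
  rw [Measure.map_map hφ hUm', AEMeasurable.map_map_of_aemeasurable hφ.aemeasurable hXm] at h2
  exact h2

end process

section optimal
variable {Ω₁ Ω₂ : Type*} [MeasurableSpace Ω₁] [MeasurableSpace Ω₂] {P : Measure Ω₁}
  {Q : Measure Ω₂} {m : ℕ} {X : ℤ → Ω₁ → Vec m} {Y : ℤ → Ω₂ → Vec m} {Φx Φy : Torus → CMat m}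

/-- A diagonal entry of `A Aᴴ` is the sum of the squared moduli along a row of `A`. -/
theorem TorusIntegrable.memLp_factor {Φ A : Torus → CMat m} (hΦ : TorusIntegrable Φ)
    (hA : AEStronglyMeasurable A torusMeasure) (h : ∀ᵐ θ ∂torusMeasure, A θ * (A θ)ᴴ = Φ θ)
    (i j : Fin m) : MemLp (fun θ => A θ i j) 2 torusMeasure := by
  have hm := aestronglyMeasurable_matrix_iff.1 hA i j
  rw [memLp_two_iff_integrable_sq_norm hm]
  refine (hΦ i i).norm.mono' (hm.norm.pow 2) ?_
  filter_upwards [h] with θ hθ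
  have h1 : Φ θ i i = ((∑ l, ‖A θ i l‖ ^ 2 : ℝ) : ℂ) := by
    rw [← hθ, Matrix.mul_apply, Complex.ofReal_sum]
    refine Finset.sum_congr rfl fun l _ => ?_
    rw [conjTranspose_apply, RCLike.star_def, Complex.mul_conj', Complex.ofReal_pow]
  have h2 : 0 ≤ ∑ l, ‖A θ i l‖ ^ 2 := Finset.sum_nonneg fun l _ => sq_nonneg _
  rw [h1, Complex.norm_real, Real.norm_of_nonneg h2, norm_pow, norm_norm]
  exact Finset.single_le_sum (f := fun l => ‖A θ i l‖ ^ 2) (fun l _ => sq_nonneg _)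
    (Finset.mem_univ j)

/-- Filtering one white noise through spectral factors of `Φx` and `Φy` yields a coupling. -/
theorem exists_coupling_of_factors (hX : IsZeroMeanStationaryGaussian X P)
    (hY : IsZeroMeanStationaryGaussian Y Q) (hΦx : IsSpectralDensity X P Φx)
    (hΦy : IsSpectralDensity Y Q Φy) {A B : Torus → CMat m}
    (hAm : AEStronglyMeasurable A torusMeasure) (hBm : AEStronglyMeasurable B torusMeasure)
    (hA : ∀ᵐ θ ∂torusMeasure, A θ * (A θ)ᴴ = Φx θ)
    (hB : ∀ᵐ θ ∂torusMeasure, B θ * (B θ)ᴴ = Φy θ) :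
    ∃ π, IsGaussianCoupling X P Y Q π ∧
      ∀ f : ℤ → Matrix (Fin m) (Fin m) ℝ, IsBIBO f → ∀ t, cost f t π =
        (∫ θ, (weight f θ * ((A θ - B θ) * (A θ - B θ)ᴴ)).trace ∂torusMeasure).re := by
  have hA2 := hΦx.integrable.memLp_factor hAm hA
  have hB2 := hΦy.integrable.memLp_factor hBm hB
  obtain ⟨W, hWm, hW, hW0, hWc⟩ := exists_gaussianProcess_of_factor
    (G := fun θ => Matrix.fromRows (A θ) (B θ)) (by
      rintro (a | a) l
      · exact hA2 a l
      · exact hB2 a l)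
  have hWm' : Measurable fun x p => W p x := measurable_pi_lambda _ hWm
  have hZm : Measurable fun x t => pairProcess (fun p => W p x) t :=
    measurable_pairProcess.comp hWm'
  have hg := isGaussianProcess_pairProcess hW
  set π : Measure (ℤ → Vec m × Vec m) :=
    whiteNoise.map fun x t => pairProcess (fun p => W p x) t with hπ
  have hgauss : IsGaussianProcess (fun (t : ℤ) (w : ℤ → Vec m × Vec m) => w t) π := ⟨fun I => by
    refine ⟨?_⟩
    rw [hπ, Measure.map_map (by fun_prop) hZm]
    exact (hg.hasGaussianLaw I).isGaussian_map⟩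
  have hcoup : IsGaussianCoupling X P Y Q π := by
    refine ⟨hgauss, fun k => ?_, fun t s => ?_, fun t s => ?_⟩
    · have hsm : Measurable fun (w : ℤ → Vec m × Vec m) t => w (t + k) :=
        measurable_pi_lambda _ fun r => measurable_pi_apply (r + k)
      -- The covariances depend on the two times only through their difference, so the shifted
      -- process has the same covariance and hence the same law.
      have h1 := map_gaussianProcess_eq (U := fun p => W (p.1 + k, p.2)) (U' := W)
        (hW.comp_right fun p : ℤ × (Fin m ⊕ Fin m) => (p.1 + k, p.2)) hW
        (measurable_pi_lambda _ fun p => hWm _).aemeasurable hWm'.aemeasurable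
        (fun p => hW0 _) hW0 fun p q => by
          rw [hWc, hWc p.1 q.1 p.2 q.2, add_sub_add_right_eq_sub]
      have h2 := congrArg (Measure.map fun (u : ℤ × (Fin m ⊕ Fin m) → ℝ) t => pairProcess u t) h1
      rw [Measure.map_map measurable_pairProcess (measurable_pi_lambda _ fun p => hWm _),
        Measure.map_map measurable_pairProcess hWm'] at h2
      rw [Measure.map_id', hπ, Measure.map_map hsm hZm]
      exact h2
    · rw [hπ, Measure.map_map (by fun_prop) hZm]
      refine hX.map_pair_eq hΦx (U := fun p => W (p.1, .inl p.2))
        (hW.comp_right fun p : ℤ × Fin m => (p.1, .inl p.2)) (fun p => hWm _) (fun p => hW0 _)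
        (fun s t i j => ?_) t s
      rw [hWc]
      refine congrArg _ (integral_congr_ae (hA.mono fun θ hθ => ?_))
      change _ * (A θ * (A θ)ᴴ) i j = _
      rw [hθ]
    · rw [hπ, Measure.map_map (by fun_prop) hZm]
      refine hY.map_pair_eq hΦy (U := fun p => W (p.1, .inr p.2))
        (hW.comp_right fun p : ℤ × Fin m => (p.1, .inr p.2)) (fun p => hWm _) (fun p => hW0 _)
        (fun s t i j => ?_) t s
      rw [hWc]
      refine congrArg _ (integral_congr_ae (hB.mono fun θ hθ => ?_))
      change _ * (B θ * (B θ)ᴴ) i j = _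
      rw [hθ]
  refine ⟨π, hcoup, fun f hf t => ?_⟩
  have := hgauss.isProbabilityMeasure
  have hAB : TorusIntegrable fun θ => (A θ - B θ) * (A θ - B θ)ᴴ := fun i j => by
    simp only [Matrix.mul_apply, conjTranspose_apply, Matrix.sub_apply]
    exact integrable_finsetSum _ fun l _ =>
      ((hA2 i l).sub (hB2 i l)).integrable_mul ((hA2 j l).sub (hB2 j l)).star
  have hprod : ∀ {C D : Torus → CMat m}, (∀ i j, MemLp (fun θ => C θ i j) 2 torusMeasure) →
      (∀ i j, MemLp (fun θ => D θ i j) 2 torusMeasure) →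
      TorusIntegrable fun θ => C θ * (D θ)ᴴ := fun hC hD i j => by
    simp only [Matrix.mul_apply, conjTranspose_apply]
    exact integrable_finsetSum _ fun l _ => (hC i l).integrable_mul (hD j l).star
  have hcov : ∀ t k i j, ∫ w, discrepancy w (t + k) i * discrepancy w t j ∂π =
      (∫ θ, fourier k θ * ((A θ - B θ) * (A θ - B θ)ᴴ) i j ∂torusMeasure).re := by
    intro t k i j
    rw [hπ, integral_map hZm.aemeasurable (by
      refine Measurable.aestronglyMeasurable ?_
      unfold discrepancy
      fun_prop)]
    have hWi : ∀ p q, Integrable (fun x => W p x * W q x) whiteNoise := fun p q =>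
      (hW.hasGaussianLaw_eval p).memLp_two.integrable_mul (hW.hasGaussianLaw_eval q).memLp_two
    have l : ∫ x, discrepancy (fun t => pairProcess (fun p => W p x) t) (t + k) i *
        discrepancy (fun t => pairProcess (fun p => W p x) t) t j ∂whiteNoise =
        ∫ x, W (t + k, .inl i) x * W (t, .inl j) x ∂whiteNoise -
        ∫ x, W (t + k, .inl i) x * W (t, .inr j) x ∂whiteNoise -
        ∫ x, W (t + k, .inr i) x * W (t, .inl j) x ∂whiteNoise +
        ∫ x, W (t + k, .inr i) x * W (t, .inr j) x ∂whiteNoise := by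
      rw [← integral_sub_sub_add (hWi _ _) (hWi _ _) (hWi _ _) (hWi _ _)]
      congr with x
      simp only [discrepancy, pairProcess, PiLp.sub_apply]
      ring
    rw [l, hWc, hWc, hWc, hWc, ← Complex.sub_re, ← Complex.sub_re, ← Complex.add_re,
      add_sub_cancel_left]
    change (∫ θ, fourier k θ * (A θ * (A θ)ᴴ) i j ∂torusMeasure -
      ∫ θ, fourier k θ * (A θ * (B θ)ᴴ) i j ∂torusMeasure -
      ∫ θ, fourier k θ * (B θ * (A θ)ᴴ) i j ∂torusMeasure +
      ∫ θ, fourier k θ * (B θ * (B θ)ᴴ) i j ∂torusMeasure).re = _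
    rw [← integral_sub_sub_add (integrable_fourier_mul (hprod hA2 hA2 i j) k)
        (integrable_fourier_mul (hprod hA2 hB2 i j) k)
        (integrable_fourier_mul (hprod hB2 hA2 i j) k)
        (integrable_fourier_mul (hprod hB2 hB2 i j) k)]
    congr 2 with θ
    simp only [conjTranspose_sub, Matrix.sub_mul, Matrix.mul_sub, Matrix.sub_apply]
    ring
  exact (conv_second_moment (P := π) (z := fun t w => discrepancy w t)
    (Φ := fun θ => (A θ - B θ) * (A θ - B θ)ᴴ)
    (fun t => (hcoup.memLp_fst t).sub (hcoup.memLp_snd t)) hAB hcov hf.summable_entrySum t).2.2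

/-- The factors are `optimalFactor` for `Φx` and the positive root for `Φy`. One law attains the
bound simultaneously for all `t`. -/
theorem exists_optimal_coupling (hX : IsZeroMeanStationaryGaussian X P)
    (hY : IsZeroMeanStationaryGaussian Y Q) (hΦx : IsSpectralDensity X P Φx)
    (hΦy : IsSpectralDensity Y Q Φy) {f : ℤ → Matrix (Fin m) (Fin m) ℝ} (hf : IsBIBO f)
    (hΩS : IsBoundedCoercive (weight f))
    (hΦxS : IsBoundedCoercive Φx) (hΦyS : IsBoundedCoercive Φy) :
    ∃ π, IsGaussianCoupling X P Y Q π ∧ ∀ t, cost f t π =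
      ∫ θ, (hellingerIntegrand (weight f) Φx Φy θ).trace.re ∂torusMeasure := by
  have hBm := aestronglyMeasurable_sqrt_density hΦyS
  have hmul : ∀ {C D : Torus → CMat m}, AEStronglyMeasurable C torusMeasure →
      AEStronglyMeasurable D torusMeasure →
      AEStronglyMeasurable (fun θ => C θ * D θ) torusMeasure := fun hC hD =>
    (continuous_fst.matrix_mul continuous_snd).comp_aestronglyMeasurable (hC.prodMk hD)
  have hAm : AEStronglyMeasurable (fun θ => optimalFactor (weight f θ) (Φx θ) (Φy θ))
      torusMeasure :=
    hmul (hmul (hmul hΦxS.aestronglyMeasurable hΩS.aestronglyMeasurable) hBm)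
      (aestronglyMeasurable_inv (aestronglyMeasurable_crossRoot hΩS hΦxS hΦyS))
  obtain ⟨π, h1, h2⟩ := exists_coupling_of_factors hX hY hΦx hΦy hAm hBm
    (by filter_upwards [hΩS.ae_posDef, hΦxS.ae_posDef, hΦyS.ae_posDef] with θ h1 h2 h3
          using optimalFactor_mul_conjTranspose h1 h2 h3)
    (by filter_upwards [hΦyS.ae_posDef] with θ h3
        rw [sqrt_isHermitian, CFC.sqrt_mul_sqrt_self _ h3.posSemidef.nonneg])
  refine ⟨π, h1, fun t => ?_⟩
  have hi := (torusIntegrable_hellingerIntegrand hΩS hΦxS hΦyS).trace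
  rw [h2 f hf t]
  have e : ∫ θ, (weight f θ * ((optimalFactor (weight f θ) (Φx θ) (Φy θ) - CFC.sqrt (Φy θ)) *
      (optimalFactor (weight f θ) (Φx θ) (Φy θ) - CFC.sqrt (Φy θ))ᴴ)).trace ∂torusMeasure =
      ∫ θ, (hellingerIntegrand (weight f) Φx Φy θ).trace ∂torusMeasure := by
    refine integral_congr_ae ?_
    filter_upwards [hΩS.ae_posDef, hΦxS.ae_posDef, hΦyS.ae_posDef] with θ h1 h2 h3
      using optimal_cost h1 h2 h3
  rw [e]
  exact (integral_re hi).symm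

end optimal

end

end SpectralTransport

end

open SpectralTransport in
theorem proposition1 {Ω₁ Ω₂ : Type*} [MeasurableSpace Ω₁] [MeasurableSpace Ω₂]
    (P : Measure Ω₁) [IsProbabilityMeasure P] (Q : Measure Ω₂) [IsProbabilityMeasure Q]
    (m : ℕ) (X : ℤ → Ω₁ → Vec m) (Y : ℤ → Ω₂ → Vec m)
    (hX : IsZeroMeanStationaryGaussian X P) (hY : IsZeroMeanStationaryGaussian Y Q)
    (Φx Φy : Torus → CMat m)
    (hΦx : IsSpectralDensity X P Φx) (hΦy : IsSpectralDensity Y Q Φy)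
    (h : ℤ → Matrix (Fin m) (Fin m) ℝ) (hcausal : IsCausal h) (hbibo : IsBIBO h)
    (hΩS : IsBoundedCoercive (weight h))
    (hΦxS : IsBoundedCoercive Φx) (hΦyS : IsBoundedCoercive Φy) :
    -- the optimization problem is feasible
    (∃ π, IsGaussianCoupling X P Y Q π) ∧
    -- the cost of every feasible law is well defined and finite
    (∀ π, IsGaussianCoupling X P Y Q π → ∀ t : ℤ,
      (∀ᵐ w ∂π, ConvConverges h (discrepancy w) t) ∧
      Integrable (fun w => ‖conv h (discrepancy w) t‖ ^ 2) π) ∧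
    -- the integral on the right-hand side is well defined
    TorusIntegrable (hellingerIntegrand (weight h) Φx Φy) ∧
    -- the value of the problem, whatever the time `t` at which the cost is evaluated
    ∀ t : ℤ, ((transportDistSq h X P Y Q t : ℝ) : ℂ) =
      (torusIntegral (hellingerIntegrand (weight h) Φx Φy)).trace := by
  refine ⟨?_, fun π hπ t => ?_, torusIntegrable_hellingerIntegrand hΩS hΦxS hΦyS, fun t => ?_⟩
  · obtain ⟨π, hπ, -⟩ := exists_optimal_coupling hX hY hΦx hΦy hbibo hΩS hΦxS hΦyS
    exact ⟨π, hπ⟩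
  · have := hπ.cost_ge hX.gaussian hY.gaussian hΦx hΦy hbibo hΩS hΦxS hΦyS t
    exact ⟨this.1, this.2.1⟩
  · rw [trace_torusIntegral_hellingerIntegrand hΩS hΦxS hΦyS, transportDistSq]
    congr 1
    -- The infimum is a minimum, so neither nonemptiness nor boundedness below of the set of costs
    -- has to be checked separately.
    refine IsLeast.csInf_eq ⟨?_, ?_⟩
    · obtain ⟨π, hπ, hc⟩ := exists_optimal_coupling hX hY hΦx hΦy hbibo hΩS hΦxS hΦyS
      exact ⟨π, hπ, (hc t).symm⟩
    · rintro _ ⟨π, hπ, rfl⟩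
      exact (hπ.cost_ge hX.gaussian hY.gaussian hΦx hΦy hbibo hΩS hΦxS hΦyS t).2.2
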